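/- Let $L$ be a free abelian group of finite rank $n$ (written additively) acting properly by semi-simple isometries on a non-empty complete CAT(0) space $X$. Here "properly" means that every $x\in X$ has a ball $B(x,r)$, $r>0$, with $\{c\in L : cB(x,r)\cap B(x,r)\neq\emptyset\}$ finite. For an isometry $g$ of $X$ put $|g|=\inf_{x\in X}d(gx,x)$ and $\mathrm{Min}(g)=\{x\in X : d(gx,x)=|g|\}$; $g$ is semi-simple if $\mathrm{Min}(g)\neq\emptyset$. Let $M=\bigcap_{c\in L}\mathrm{Min}(c)$ be the min set of $L$. Then: 1. $M$ is non-empty, and $M$ is isometric to a product $Y\times\mathbb{E}^n$ (with the $\ell^2$ product metric) of a metric space $Y$ and Euclidean $n$-space, in such a way that (2) and (3) hold. 2. Every $c\in L$ leaves $M$ invariant, respects the product decomposition, and acts trivially on $Y$ and by a translation on $\mathbb{E}^n$. 3. For each $y\in Y$, the action of $L$ by translations on $\{y\}\times\mathbb{E}^n$ has a unique affine extension to $L\otimes\mathbb{R}$ (an action in which $v\in L\otimes\mathbb{R}$ translates by $\tau(v)$ for an $\mathbb{R}$-linear map $\tau:L\otimes\mathbb{R}\to\mathbb{R}^n$), and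 under it $\{y\}\times\mathbb{E}^n$ is a torsor for $L\otimes\mathbb{R}$, i.e. the extended action is free and transitive. 4. There is a unique bilinear form $\langle\cdot,\cdot\rangle_L$ on $L\otimes\mathbb{R}$ such that $$\langle b\otimes 1,c\otimes 1\rangle_L=\tfrac12\bigl(d((b+c)x,x)^2-d(x,bx)^2-d(x,cx)^2\bigr)\qquad\text{for all } b,c\in L \text{ and } x\in M,$$ and it is an inner product (symmetric and positive definite). Let $\varphi$ be any isometry of $X$ that commensurates (the image in $\mathrm{Isom}(X)$ of) $L$, that is, $L\cap\varphi L\varphi^{-1}$ has finite index in both $L$ and $\varphi L\varphi^{-1}$. Then conjugation by $\varphi$ gives an isomorphism $\phi:L'\to L''$ between finite-index subgroups of $L$; with the inclusions $i:L'\to L$ and $j:L''\to L$, the automorphism $\tilde\phi=(j\otimes1)\circ(\phi\otimes1)\circ(i\otimes1)^{-1}\in GL(L\otimes\mathbb{Q})$ does not depend on the choice of such $L'$ and $L''$, and its image in $GL(L\otimes\mathbb{R})$ preserves $\langle\cdot,\cdot\rangle_L$: $\langle\tilde\phi(v),\tilde\phi(w)\rangle_L=\langle v,w\rangle_L$ for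 all $v,w\in L\otimes\mathbb{R}$. -/

import Mathlib

open scoped TensorProduct

universe u w

namespace FlatTorus

section MetricNotions

variable {X : Type*} [MetricSpace X]

/-- `γ`, restricted to `[0, 1]`, is a (linearly reparametrized) geodesic from `x` to `y`. -/
def IsGeodesic (x y : X) (γ : ℝ → X) : Prop :=
  γ 0 = x ∧ γ 1 = y ∧
    ∀ s ∈ Set.Icc (0 : ℝ) 1, ∀ t ∈ Set.Icc (0 : ℝ) 1, dist (γ s) (γ t) = |s - t| * dist x y

/-- `X` is a CAT(0) space: any two points are joined by a geodesic, and every geodesic triangle is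
at least as thin as its comparison triangle in the Euclidean plane. Two points on one and the same
side are at the same distance as their comparison points, so it suffices to compare points on two
sides `[x, y]` and `[x, z]`, where `x` is any one of the vertices. -/
structure IsCAT0 (X : Type*) [MetricSpace X] : Prop where
  exists_geodesic : ∀ x y : X, ∃ γ : ℝ → X, IsGeodesic x y γ
  thin : ∀ (x y z : X) (γ η : ℝ → X), IsGeodesic x y γ → IsGeodesic x z η →
    ∀ x' y' z' : EuclideanSpace ℝ (Fin 2),
      dist x' y' = dist x y → dist x' z' = dist x z → dist y' z' = dist y z →
      ∀ s ∈ Set.Icc (0 : ℝ) 1, ∀ t ∈ Set.Icc (0 : ℝ) 1,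
        dist (γ s) (η t) ≤ dist (AffineMap.lineMap x' y' s) (AffineMap.lineMap x' z' t)

/-- The translation length `|g| = inf {d(g x, x) | x ∈ X}` of an isometry `g`. -/
noncomputable def translationLength (g : X ≃ᵢ X) : ℝ := ⨅ x : X, dist (g x) x

/-- The min set of an isometry: the points where the displacement attains its infimum. -/
def isomMinSet (g : X ≃ᵢ X) : Set X := {x | dist (g x) x = translationLength g}

/-- An isometry is semi-simple if its displacement function attains its infimum. -/
def IsSemisimpleIsom (g : X ≃ᵢ X) : Prop := (isomMinSet g).Nonempty

end MetricNotions

section Actions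

variable {X L : Type*} [MetricSpace X] [AddCommGroup L]

/-- The isometry of `X` by which `c ∈ L` acts. -/
def act (ρ : Multiplicative L →* (X ≃ᵢ X)) (c : L) : X ≃ᵢ X := ρ (Multiplicative.ofAdd c)

/-- The action is proper: every point has a ball that meets only finitely many of its
translates. -/
def IsProperAction (ρ : Multiplicative L →* (X ≃ᵢ X)) : Prop :=
  ∀ x : X, ∃ r > 0,
    {c : L | ((act ρ c '' Metric.ball x r) ∩ Metric.ball x r).Nonempty}.Finite

/-- The min set of the action: the intersection of the min sets of all elements of `L`. -/
def minSet (ρ : Multiplicative L →* (X ≃ᵢ X)) : Set X := ⋂ c : L, isomMinSet (act ρ c)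

/-- `B` is the bilinear extension to `L ⊗ ℝ` of
`⟨b, c⟩ = (d((b + c) x, x)² - d(x, b x)² - d(x, c x)²) / 2`, for any `x` in the min set. -/
def IsInnerProductOf (ρ : Multiplicative L →* (X ≃ᵢ X))
    (B : LinearMap.BilinForm ℝ (ℝ ⊗[ℤ] L)) : Prop :=
  ∀ x ∈ minSet ρ, ∀ b c : L,
    B (1 ⊗ₜ b) (1 ⊗ₜ c) =
      (dist (act ρ (b + c) x) x ^ 2 - dist x (act ρ b x) ^ 2 - dist x (act ρ c x) ^ 2) / 2

/-- The product `Y × 𝔼ⁿ` with the `ℓ²` product metric. -/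
abbrev EuclideanProd (Y : Type*) (n : ℕ) : Type _ := WithLp 2 (Y × EuclideanSpace ℝ (Fin n))

/-- Given an identification `e` of the min set with `Y × 𝔼ⁿ`, the point of `X` with
coordinates `(y, p)`. -/
noncomputable def pt {ρ : Multiplicative L →* (X ≃ᵢ X)} {Y : Type*} [MetricSpace Y] {n : ℕ}
    (e : minSet ρ ≃ᵢ EuclideanProd Y n) (y : Y) (p : EuclideanSpace ℝ (Fin n)) : X :=
  (e.symm (WithLp.toLp 2 (y, p)) : X)

/-- The action of `L ⊗ ℝ` on `{y} × 𝔼ⁿ` in which `v` translates by `τ v`, with `τ` linear, is an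
affine extension of the action of `L`. -/
def IsAffineExtension {ρ : Multiplicative L →* (X ≃ᵢ X)} {Y : Type*} [MetricSpace Y] {n : ℕ}
    (e : minSet ρ ≃ᵢ EuclideanProd Y n) (y : Y)
    (τ : (ℝ ⊗[ℤ] L) →ₗ[ℝ] EuclideanSpace ℝ (Fin n)) : Prop :=
  ∀ (c : L) (p : EuclideanSpace ℝ (Fin n)), act ρ c (pt e y p) = pt e y (τ (1 ⊗ₜ c) + p)

/-- The action of `V` on the non-empty set `E` through translations by `τ v` is free and
transitive, that is, it makes `E` a torsor for `V`. -/
def TranslationsAreTorsor {V E : Type*} [AddCommGroup V] [Module ℝ V] [AddCommGroup E] [Module ℝ E]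
    (τ : V →ₗ[ℝ] E) : Prop :=
  (∀ (v : V) (p : E), τ v + p = p → v = 0) ∧ ∀ p q : E, ∃ v : V, τ v + p = q

end Actions

section Commensurator

variable {L : Type*} [AddCommGroup L]

/-- The map `i ⊗ 1 : L' ⊗ ℚ → L ⊗ ℚ` given by the inclusion `i` of a subgroup `L'` of `L`. -/
noncomputable def inclQ (L' : AddSubgroup L) : (ℚ ⊗[ℤ] L') →ₗ[ℚ] (ℚ ⊗[ℤ] L) :=
  L'.subtype.toIntLinearMap.baseChange ℚ

theorem inclQ_bijective (L' : AddSubgroup L) [L'.FiniteIndex] : Function.Bijective (inclQ L') := by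
  constructor
  · exact Module.Flat.lTensor_preserves_injective_linearMap (M := ℚ) L'.subtype.toIntLinearMap
      L'.subtype_injective
  · intro z
    induction z using TensorProduct.induction_on with
    | zero => exact ⟨0, map_zero _⟩
    | add a b ha hb =>
      obtain ⟨a', rfl⟩ := ha
      obtain ⟨b', rfl⟩ := hb
      exact ⟨a' + b', map_add _ _ _⟩
    | tmul q l =>
      have hm : L'.index ≠ 0 := AddSubgroup.FiniteIndex.index_ne_zero
      have hmem : (L'.index : ℤ) • l ∈ L' := by
        rw [natCast_zsmul]
        exact AddSubgroup.nsmul_index_mem L' l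
      refine ⟨(q / L'.index) ⊗ₜ ⟨(L'.index : ℤ) • l, hmem⟩, ?_⟩
      change (q / L'.index) ⊗ₜ[ℤ] ((L'.index : ℤ) • l) = q ⊗ₜ l
      rw [TensorProduct.tmul_smul, TensorProduct.smul_tmul']
      congr 1
      have : (L'.index : ℚ) ≠ 0 := by exact_mod_cast hm
      simp only [zsmul_eq_mul, Int.cast_natCast]
      field_simp

/-- The element `(j ⊗ 1) ∘ (ϕ ⊗ 1) ∘ (i ⊗ 1)⁻¹` of `GL(L ⊗ ℚ)` given by an isomorphism
`ϕ : L' → L''` between finite-index subgroups of `L`, with inclusions `i` and `j`. -/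
noncomputable def commMap (L' L'' : AddSubgroup L) [L'.FiniteIndex] [L''.FiniteIndex]
    (ϕ : L' ≃+ L'') : (ℚ ⊗[ℤ] L) ≃ₗ[ℚ] (ℚ ⊗[ℤ] L) :=
  ((LinearEquiv.ofBijective (inclQ L') (inclQ_bijective L')).symm.trans
    (ϕ.toIntLinearEquiv.baseChange ℤ ℚ L' L'')).trans
      (LinearEquiv.ofBijective (inclQ L'') (inclQ_bijective L''))

/-- `ϕ : L' → L''` is conjugation by the isometry `φ`. -/
def IsConjugationBy {X : Type*} [MetricSpace X] (ρ : Multiplicative L →* (X ≃ᵢ X)) (φ : X ≃ᵢ X)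
    {L' L'' : AddSubgroup L} (ϕ : L' ≃+ L'') : Prop :=
  ∀ b : L', act ρ (ϕ b : L) = φ * act ρ (b : L) * φ⁻¹

/-- `T ∈ GL(L ⊗ ℚ)` is the image of `φ`: conjugation by `φ` is an isomorphism between some
finite-index subgroups of `L`, and every such isomorphism represents `T`. -/
def IsImageOf {X : Type*} [MetricSpace X] (ρ : Multiplicative L →* (X ≃ᵢ X)) (φ : X ≃ᵢ X)
    (T : (ℚ ⊗[ℤ] L) ≃ₗ[ℚ] (ℚ ⊗[ℤ] L)) : Prop :=
  (∃ (L' L'' : AddSubgroup L) (ϕ : L' ≃+ L''),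
    L'.FiniteIndex ∧ L''.FiniteIndex ∧ IsConjugationBy ρ φ ϕ) ∧
  ∀ (L' L'' : AddSubgroup L) [L'.FiniteIndex] [L''.FiniteIndex] (ϕ : L' ≃+ L''),
    IsConjugationBy ρ φ ϕ → commMap L' L'' ϕ = T

/-- The inclusion `GL(L ⊗ ℚ) → GL(L ⊗ ℝ)`, through `ℝ ⊗ (ℚ ⊗ L) = ℝ ⊗ L`. -/
noncomputable def extendToReal (T : (ℚ ⊗[ℤ] L) ≃ₗ[ℚ] (ℚ ⊗[ℤ] L)) :
    (ℝ ⊗[ℤ] L) ≃ₗ[ℝ] (ℝ ⊗[ℤ] L) :=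
  ((TensorProduct.AlgebraTensorModule.cancelBaseChange ℤ ℚ ℝ ℝ L).symm.trans
    (T.baseChange ℚ ℝ (ℚ ⊗[ℤ] L) (ℚ ⊗[ℤ] L))).trans
      (TensorProduct.AlgebraTensorModule.cancelBaseChange ℤ ℚ ℝ ℝ L)

end Commensurator

end FlatTorus

/-!
The flat torus theorem is deduced from two consequences of the CAT(0) condition: the CN inequality
`IsCAT0.cn`, and the quadrilateral inequality `IsCAT0.quadrilateral`, by which the squared
diagonals of a quadrilateral add up to at most the sum of its squared sides.

*Displacements.* For `x ∈ X` let `q(c) = d(x, c x)²`. The quadrilateral `x, a x, (a + b) x, b x`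
gives `q(a + b) + q(a - b) ≤ 2 q(a) + 2 q(b)`. If `x` lies in `Min(a) ∩ Min(b)`, then
`q(2a) = 4 q(a)` and `q(2b) = 4 q(b)`, and the same inequality for `a + b` and `a - b` forces
equality (`IsCAT0.parallelogram`). The same for `2ᵏ a` and `2ᵏ b` shows
`q(2ᵏ (a + b)) = 4ᵏ q(a + b)` for all `k`, which implies `x ∈ Min(a + b)`: the
elements of `L` minimized at `x` form a subgroup (`minimizedAt`). So the min set of
`L` is that of a finite generating set, and it is non-empty by projecting from one min set to the next (`IsCAT0.nonempty_biInter_isomMinSet`). On it, the squared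
translation length is a quadratic form on `L`; a square root of its Gram matrix realizes `L` by
vectors `T c ∈ 𝔼ⁿ` with `‖T c‖ = |c|`, and since the action is proper, these form a lattice of full
rank (`IsCAT0.exists_translation_map`). The inner product on `L ⊗ ℝ` is the one pulled back by `T`.

*Product decomposition.* For `x, y` in the min set, `f(c) = d(x, c y)²` satisfies
`f(c + a) + f(c - a) = 2 f(c) + 2 ‖T a‖²`: one inequality is CN, the other is the quadrilateral
inequality. So `f(c) = d(x, y)² + ‖T c‖² - 2 ⟪p, T c⟫` for some `p ∈ 𝔼ⁿ`, and by the triangle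
inequality `p = P x - P y` for a function `P` on the min set (`IsCAT0.exists_isFlatCoordinate`).
Then `d(x, y)² - ‖P x - P y‖²` is invariant under `L` in each variable. By CN, moving `x` along the
segment from `x` to `c x` translates `P x` along `T c` and does not change this quantity either;
such moves compose to translations of the min set by all vectors of `𝔼ⁿ`
(`IsFlatCoordinate.exists_isTranslate`), and the min set is the product of the slice `P = 0` with
`𝔼ⁿ` (`IsCAT0.exists_isometryEquiv`).

*Commensurator.* Conjugation preserves translation lengths, so it preserves the inner product of
elements of a finite-index subgroup of `L`, and such a subgroup spans `L ⊗ ℝ`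
(`linearMap_ext_of_finiteIndex`).
-/

namespace FlatTorus

/-! ### CAT(0) geometry -/

section CAT0
variable {X : Type*} [MetricSpace X]

/-- `m` divides the segment from `x` to `y` in the ratio `t : 1 - t`. In a CAT(0) space this
determines `m`, so that geodesics can be handled through their points. -/
def Divides (x y : X) (t : ℝ) (m : X) : Prop :=
  dist x m = t * dist x y ∧ dist m y = (1 - t) * dist x y

theorem Divides.symm {x y m : X} {t : ℝ} (h : Divides x y t m) : Divides y x (1 - t) m := by
  refine ⟨?_, ?_⟩
  · rw [dist_comm y m, dist_comm y x, h.2]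
  · rw [dist_comm m x, dist_comm y x, h.1]; ring

theorem Divides.map {x y m : X} {t : ℝ} (h : Divides x y t m) (g : X ≃ᵢ X) :
    Divides (g x) (g y) t (g m) := by
  simpa only [Divides, g.dist_eq] using h

theorem IsGeodesic.divides {x y : X} {γ : ℝ → X} (h : IsGeodesic x y γ) {t : ℝ}
    (ht : t ∈ Set.Icc (0 : ℝ) 1) : Divides x y t (γ t) := by
  obtain ⟨h0, h1, h⟩ := h
  constructor
  · have := h 0 (by simp) t ht
    rw [h0] at this
    rw [this, zero_sub, abs_neg, abs_of_nonneg ht.1]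
  · have := h t ht 1 (by simp)
    rw [h1] at this
    rw [this, abs_sub_comm, abs_of_nonneg (by linarith [ht.2])]

theorem exists_comparison_triangle (x y z : X) : ∃ x' y' z' : EuclideanSpace ℝ (Fin 2),
    dist x' y' = dist x y ∧ dist x' z' = dist x z ∧ dist y' z' = dist y z := by
  set a := dist x y
  set b := dist x z
  set c := dist y z
  have ha : 0 ≤ a := dist_nonneg
  have hb : 0 ≤ b := dist_nonneg
  have hc : 0 ≤ c := dist_nonneg
  have h1 : c ≤ a + b := by
    have := dist_triangle y x z
    rwa [dist_comm y x] at this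
  have h2 : b ≤ a + c := dist_triangle x y z
  have h3 : a ≤ b + c := by
    have := dist_triangle x z y
    rwa [dist_comm z y] at this
  -- the law of cosines gives the first coordinate of the third vertex
  obtain ⟨u, hu, hub⟩ : ∃ u : ℝ, 2 * a * u = a ^ 2 + b ^ 2 - c ^ 2 ∧ u ^ 2 ≤ b ^ 2 := by
    rcases ha.eq_or_lt with h0 | h0
    · refine ⟨0, ?_, by simpa using sq_nonneg b⟩
      have : b = c := le_antisymm (by linarith) (by linarith)
      rw [← h0, this]; ring
    · refine ⟨(a ^ 2 + b ^ 2 - c ^ 2) / (2 * a), by field_simp, ?_⟩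
      rw [sq_le_sq, abs_of_nonneg hb, abs_le]
      constructor
      · rw [le_div_iff₀ (by positivity)]
        nlinarith
      · rw [div_le_iff₀ (by positivity)]
        nlinarith
  have hv : √(b ^ 2 - u ^ 2) ^ 2 = b ^ 2 - u ^ 2 := Real.sq_sqrt (by linarith)
  refine ⟨0, !₂[a, 0], !₂[u, √(b ^ 2 - u ^ 2)], ?_, ?_, ?_⟩
  · simp [EuclideanSpace.dist_eq, Real.dist_eq, Real.sqrt_sq_eq_abs, abs_of_nonneg ha]
  · simp [EuclideanSpace.dist_eq, Real.dist_eq, hv, hb]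
  · rw [EuclideanSpace.dist_eq, ← Real.sqrt_sq hc]
    congr 1
    simp [Real.dist_eq, hv]
    linarith

theorem dist_sq_lineMap {E : Type*} [NormedAddCommGroup E] [InnerProductSpace ℝ E]
    (x y z : E) (t : ℝ) :
    dist (AffineMap.lineMap x y t) z ^ 2 =
      (1 - t) * dist x z ^ 2 + t * dist y z ^ 2 - t * (1 - t) * dist x y ^ 2 := by
  have h1 : AffineMap.lineMap x y t - z = (1 - t) • (x - z) + t • (y - z) := by
    rw [AffineMap.lineMap_apply_module]; module
  have h2 : x - y = (x - z) - (y - z) := by abel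
  rw [dist_eq_norm, dist_eq_norm, dist_eq_norm, dist_eq_norm, h1, h2, norm_add_sq_real,
    norm_sub_sq_real (x - z), norm_smul, norm_smul, inner_smul_left, inner_smul_right, mul_pow,
    mul_pow, Real.norm_eq_abs, Real.norm_eq_abs, sq_abs, sq_abs]
  simp only [conj_trivial]
  ring

namespace IsCAT0
variable (hX : IsCAT0 X)
include hX

theorem cn_geodesic {x y : X} {γ : ℝ → X} (h : IsGeodesic x y γ) (w : X) {t : ℝ}
    (ht : t ∈ Set.Icc (0 : ℝ) 1) :
    dist (γ t) w ^ 2 ≤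
      (1 - t) * dist x w ^ 2 + t * dist y w ^ 2 - t * (1 - t) * dist x y ^ 2 := by
  obtain ⟨η, hη⟩ := hX.exists_geodesic x w
  obtain ⟨x', y', z', h1, h2, h3⟩ := exists_comparison_triangle x y w
  have := hX.thin x y w γ η h hη x' y' z' h1 h2 h3 t ht 1 (by simp)
  rw [hη.2.1, AffineMap.lineMap_apply_one] at this
  rw [← h1, ← h2, ← h3, ← dist_sq_lineMap]
  gcongr

theorem exists_divides (x y : X) {t : ℝ} (ht : t ∈ Set.Icc (0 : ℝ) 1) :
    ∃ m, Divides x y t m := by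
  obtain ⟨γ, hγ⟩ := hX.exists_geodesic x y
  exact ⟨γ t, hγ.divides ht⟩

theorem eq_of_divides {x y m : X} {γ : ℝ → X} (h : IsGeodesic x y γ) {t : ℝ}
    (ht : t ∈ Set.Icc (0 : ℝ) 1) (hm : Divides x y t m) : γ t = m := by
  have := hX.cn_geodesic h m ht
  rw [hm.1, dist_comm y m, hm.2] at this
  have h0 : dist (γ t) m ^ 2 ≤ 0 := by nlinarith
  exact dist_eq_zero.1 (pow_eq_zero_iff two_ne_zero |>.1 (le_antisymm h0 (sq_nonneg _)))

/-- The inequality of Bruhat and Tits (the "CN inequality") at an arbitrary point of a segment. -/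
theorem cn {x y m : X} {t : ℝ} (ht : t ∈ Set.Icc (0 : ℝ) 1) (hm : Divides x y t m) (w : X) :
    dist m w ^ 2 ≤
      (1 - t) * dist x w ^ 2 + t * dist y w ^ 2 - t * (1 - t) * dist x y ^ 2 := by
  obtain ⟨γ, hγ⟩ := hX.exists_geodesic x y
  rw [← hX.eq_of_divides hγ ht hm]
  exact hX.cn_geodesic hγ w ht

theorem dist_le_of_divides {x y z m k : X} {t : ℝ} (ht : t ∈ Set.Icc (0 : ℝ) 1)
    (hm : Divides x y t m) (hk : Divides x z t k) : dist m k ≤ t * dist y z := by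
  obtain ⟨γ, hγ⟩ := hX.exists_geodesic x y
  obtain ⟨η, hη⟩ := hX.exists_geodesic x z
  obtain ⟨x', y', z', h1, h2, h3⟩ := exists_comparison_triangle x y z
  have := hX.thin x y z γ η hγ hη x' y' z' h1 h2 h3 t ht t ht
  rw [hX.eq_of_divides hγ ht hm, hX.eq_of_divides hη ht hk, dist_eq_norm,
    AffineMap.lineMap_apply_module, AffineMap.lineMap_apply_module,
    show ((1 - t) • x' + t • y') - ((1 - t) • x' + t • z') = t • (y' - z') by module,
    norm_smul, ← dist_eq_norm, h3, Real.norm_of_nonneg ht.1] at this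
  exact this

/-- Convexity of the metric. -/
theorem dist_convex {x y x' y' m m' : X} {t : ℝ} (ht : t ∈ Set.Icc (0 : ℝ) 1)
    (hm : Divides x y t m) (hm' : Divides x' y' t m') :
    dist m m' ≤ (1 - t) * dist x x' + t * dist y y' := by
  obtain ⟨k, hk⟩ := hX.exists_divides x y' ht
  have ht' : 1 - t ∈ Set.Icc (0 : ℝ) 1 := ⟨by linarith [ht.2], by linarith [ht.1]⟩
  have h1 := hX.dist_le_of_divides ht hm hk
  have h2 := hX.dist_le_of_divides ht' hk.symm hm'.symm
  linarith [dist_triangle m k m']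

/-- The quadrilateral inequality: the squared diagonals add up to at most the sum of the squared
sides. -/
theorem quadrilateral (x y z w : X) :
    dist x z ^ 2 + dist y w ^ 2 ≤
      dist x y ^ 2 + dist y z ^ 2 + dist z w ^ 2 + dist w x ^ 2 := by
  have ht : (1 / 2 : ℝ) ∈ Set.Icc (0 : ℝ) 1 := by norm_num
  obtain ⟨m, hm⟩ := hX.exists_divides x z ht
  have h1 := hX.cn ht hm y
  have h2 := hX.cn ht hm w
  have h3 : dist y w ≤ dist m y + dist m w := dist_triangle_left y w m
  have h4 : dist y w ^ 2 ≤ (dist m y + dist m w) ^ 2 := by gcongr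
  rw [dist_comm z y] at h1
  rw [dist_comm x w] at h2
  nlinarith [sq_nonneg (dist m y - dist m w)]

end IsCAT0

/-- `C` contains the segment between any two of its points. -/
def GeodesicallyConvex (C : Set X) : Prop :=
  ∀ ⦃x⦄, x ∈ C → ∀ ⦃y⦄, y ∈ C → ∀ t ∈ Set.Icc (0 : ℝ) 1, ∀ m, Divides x y t m → m ∈ C

/-- `p` is a point of `C` nearest to `x`. -/
def IsNearest (C : Set X) (x p : X) : Prop := p ∈ C ∧ ∀ y ∈ C, dist x p ≤ dist x y

namespace IsCAT0
variable (hX : IsCAT0 X)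
include hX

theorem exists_nearest [CompleteSpace X] {C : Set X} (hne : C.Nonempty) (hcl : IsClosed C)
    (hC : GeodesicallyConvex C) (x : X) : ∃ p, IsNearest C x p := by
  have ht : (1 / 2 : ℝ) ∈ Set.Icc (0 : ℝ) 1 := by norm_num
  set r := Metric.infDist x C
  have hr : 0 ≤ r := Metric.infDist_nonneg
  have hle : ∀ y ∈ C, r ≤ dist x y := fun y hy => Metric.infDist_le_dist_of_mem hy
  -- points of `C` that nearly realize the distance are close to each other
  have key : ∀ y ∈ C, ∀ z ∈ C, ∀ ε : ℝ, dist x y ^ 2 ≤ r ^ 2 + ε → dist x z ^ 2 ≤ r ^ 2 + ε →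
      dist y z ^ 2 ≤ 4 * ε := by
    intro y hy z hz ε h1 h2
    obtain ⟨m, hm⟩ := hX.exists_divides y z ht
    have h3 := hX.cn ht hm x
    have h4 : r ^ 2 ≤ dist x m ^ 2 := by
      gcongr
      exact hle m (hC hy hz _ ht m hm)
    rw [dist_comm m x, dist_comm y x, dist_comm z x] at h3
    linarith
  have hex : ∀ k : ℕ, ∃ y ∈ C, dist x y ^ 2 < r ^ 2 + 1 / ((k : ℝ) + 1) := by
    intro k
    have hpos : (0 : ℝ) < 1 / ((k : ℝ) + 1) := by positivity
    have : r < √(r ^ 2 + 1 / ((k : ℝ) + 1)) := Real.lt_sqrt_of_sq_lt (by linarith)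
    obtain ⟨y, hy, h⟩ := (Metric.infDist_lt_iff hne).1 this
    exact ⟨y, hy, (Real.lt_sqrt dist_nonneg).1 h⟩
  choose s hs hsd using hex
  have hlim : Filter.Tendsto (fun k : ℕ => 1 / ((k : ℝ) + 1)) Filter.atTop (nhds 0) :=
    tendsto_one_div_add_atTop_nhds_zero_nat
  have hcauchy : CauchySeq s := by
    refine cauchySeq_of_le_tendsto_0 (fun k : ℕ => √(4 * (1 / ((k : ℝ) + 1)))) ?_ ?_
    · intro i j k hi hj
      refine Real.le_sqrt_of_sq_le (key _ (hs i) _ (hs j) _ ((hsd i).le.trans ?_)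
        ((hsd j).le.trans ?_)) <;> gcongr
    · have := (hlim.const_mul 4).sqrt
      simpa using this
  obtain ⟨p, hp⟩ := cauchySeq_tendsto_of_complete hcauchy
  have hpC : p ∈ C := hcl.mem_of_tendsto hp (Filter.Eventually.of_forall hs)
  refine ⟨p, hpC, fun y hy => ?_⟩
  have h1 : Filter.Tendsto (fun k => dist x (s k) ^ 2) Filter.atTop (nhds (dist x p ^ 2)) :=
    (tendsto_const_nhds.dist hp).pow 2
  have h2 : dist x p ^ 2 ≤ r ^ 2 + 0 :=
    le_of_tendsto_of_tendsto' h1 (tendsto_const_nhds.add hlim) fun k => (hsd k).le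
  have h3 : dist x p ≤ r := by
    rw [add_zero] at h2
    exact (sq_le_sq₀ dist_nonneg hr).1 h2
  exact h3.trans (hle y hy)

/-- The angle at a nearest point is not acute. -/
theorem pythagoras_nearest {C : Set X} (hC : GeodesicallyConvex C) {x p : X}
    (hp : IsNearest C x p) {y : X} (hy : y ∈ C) :
    dist x p ^ 2 + dist p y ^ 2 ≤ dist x y ^ 2 := by
  have key : ∀ t ∈ Set.Ioc (0 : ℝ) 1, dist x p ^ 2 + (1 - t) * dist p y ^ 2 ≤ dist x y ^ 2 := by
    intro t ht
    have ht' : t ∈ Set.Icc (0 : ℝ) 1 := ⟨ht.1.le, ht.2⟩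
    obtain ⟨m, hm⟩ := hX.exists_divides p y ht'
    have h1 := hX.cn ht' hm x
    have h2 : dist x p ^ 2 ≤ dist m x ^ 2 := by
      rw [dist_comm m x]
      gcongr
      exact hp.2 m (hC hp.1 hy t ht' m hm)
    rw [dist_comm p x, dist_comm y x] at h1
    have h3 : t * (dist x p ^ 2 + (1 - t) * dist p y ^ 2) ≤ t * dist x y ^ 2 := by linarith
    exact le_of_mul_le_mul_left h3 ht.1
  have hlim : Filter.Tendsto (fun t : ℝ => dist x p ^ 2 + (1 - t) * dist p y ^ 2)
      (nhdsWithin 0 (Set.Ioi 0)) (nhds (dist x p ^ 2 + (1 - 0) * dist p y ^ 2)) :=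
    ((continuous_const.add ((continuous_const.sub continuous_id).mul continuous_const)).tendsto
      0).mono_left nhdsWithin_le_nhds
  have := le_of_tendsto hlim (Filter.mem_of_superset (Ioc_mem_nhdsGT one_pos) key)
  simpa using this

theorem dist_nearest_le {C : Set X} (hC : GeodesicallyConvex C) {x y p q : X}
    (hp : IsNearest C x p) (hq : IsNearest C y q) : dist p q ≤ dist x y := by
  have h1 := hX.pythagoras_nearest hC hp hq.1
  have h2 := hX.pythagoras_nearest hC hq hp.1
  have h3 := hX.quadrilateral x y q p
  rw [dist_comm q p] at h2 h3
  rw [dist_comm p x] at h3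
  exact (sq_le_sq₀ dist_nonneg dist_nonneg).1 (by linarith)

end IsCAT0
end CAT0

/-! ### Min sets of commuting isometries -/

section MinSets
variable {X : Type*} [MetricSpace X]

theorem mem_isomMinSet_iff {g : X ≃ᵢ X} {x : X} :
    x ∈ isomMinSet g ↔ ∀ y, dist (g x) x ≤ dist (g y) y := by
  have hb : BddBelow (Set.range fun y : X => dist (g y) y) :=
    ⟨0, by rintro _ ⟨y, rfl⟩; exact dist_nonneg⟩
  constructor
  · intro h y
    rw [show dist (g x) x = translationLength g from h]
    exact ciInf_le hb y
  · intro h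
    have : Nonempty X := ⟨x⟩
    exact le_antisymm (le_ciInf h) (ciInf_le hb x)

theorem isClosed_isomMinSet (g : X ≃ᵢ X) : IsClosed (isomMinSet g) :=
  isClosed_eq (g.continuous.dist continuous_id) continuous_const

theorem IsCAT0.convex_isomMinSet (hX : IsCAT0 X) (g : X ≃ᵢ X) :
    GeodesicallyConvex (isomMinSet g) := by
  intro x hx y hy t ht m hm
  rw [mem_isomMinSet_iff] at hx hy ⊢
  intro z
  have h1 := hX.dist_convex ht (hm.map g) hm
  have h2 := mul_le_mul_of_nonneg_left (hx z) (sub_nonneg.2 ht.2)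
  have h3 := mul_le_mul_of_nonneg_left (hy z) ht.1
  linarith

theorem map_mem_isomMinSet {g h : X ≃ᵢ X} (hc : ∀ x, g (h x) = h (g x)) {x : X}
    (hx : x ∈ isomMinSet g) : h x ∈ isomMinSet g := by
  rw [mem_isomMinSet_iff] at hx ⊢
  intro y
  rw [hc, h.dist_eq]
  exact hx y

theorem translationLength_conj (φ g : X ≃ᵢ X) :
    translationLength (φ * g * φ⁻¹) = translationLength g := by
  unfold translationLength
  refine (φ.surjective.iInf_comp fun x => dist ((φ * g * φ⁻¹) x) x).symm.trans ?_
  congr 1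
  ext x
  simp only [IsometryEquiv.mul_apply, IsometryEquiv.inv_apply_self, φ.dist_eq]

variable {L : Type*} [AddCommGroup L] (ρ : Multiplicative L →* (X ≃ᵢ X))

theorem act_add (a b : L) (x : X) : act ρ (a + b) x = act ρ a (act ρ b x) := by
  simp [act, ofAdd_add]

theorem act_zero (x : X) : act ρ 0 x = x := by
  simp [act]

theorem act_comm (a b : L) (x : X) : act ρ a (act ρ b x) = act ρ b (act ρ a x) := by
  rw [← act_add, add_comm, act_add]

theorem dist_act_act (a b : L) (x y : X) :
    dist (act ρ a x) (act ρ b y) = dist x (act ρ (b - a) y) := by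
  rw [← (act ρ a).dist_eq x, ← act_add, add_sub_cancel]

theorem dist_act_neg (c : L) (x : X) : dist x (act ρ (-c) x) = dist x (act ρ c x) := by
  rw [← zero_sub, ← dist_act_act, act_zero, dist_comm]

theorem dist_act_sub_rev (a b : L) (x : X) :
    dist x (act ρ (a - b) x) = dist x (act ρ (b - a) x) := by
  rw [← dist_act_neg, neg_sub]

theorem IsCAT0.parallelogram_le (hX : IsCAT0 X) (a b : L) (x : X) :
    dist x (act ρ (a + b) x) ^ 2 + dist x (act ρ (a - b) x) ^ 2 ≤
      2 * dist x (act ρ a x) ^ 2 + 2 * dist x (act ρ b x) ^ 2 := by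
  have h := hX.quadrilateral x (act ρ a x) (act ρ (a + b) x) (act ρ b x)
  rw [dist_act_act, dist_act_act, dist_act_act, add_sub_cancel_left, dist_comm (act ρ b x) x,
    dist_act_sub_rev, dist_act_sub_rev ρ b, add_sub_cancel_right] at h
  linarith

/-- The translation length of `2c` is twice that of `c`, and it is attained where that of `c` is:
`c` moves the midpoint of `y` and `c y` by at most half of `d(y, 2c y)`. -/
theorem IsCAT0.two_mul_dist_le (hX : IsCAT0 X) {c : L} {x : X} (hx : x ∈ isomMinSet (act ρ c))
    (y : X) : 2 * dist x (act ρ c x) ≤ dist y (act ρ (c + c) y) := by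
  have ht : (1 / 2 : ℝ) ∈ Set.Icc (0 : ℝ) 1 := by norm_num
  obtain ⟨m, hm⟩ := hX.exists_divides y (act ρ c y) ht
  have h1 : Divides (act ρ c y) y (1 / 2) m := by
    have := hm.symm
    norm_num at this ⊢
    exact this
  have h2 := hX.dist_le_of_divides ht h1 (hm.map (act ρ c))
  have h3 := mem_isomMinSet_iff.1 hx m
  rw [dist_comm, dist_comm _ m] at h3
  rw [← act_add] at h2
  linarith

theorem IsCAT0.dist_double (hX : IsCAT0 X) {c : L} {x : X} (hx : x ∈ isomMinSet (act ρ c)) :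
    dist x (act ρ (c + c) x) = 2 * dist x (act ρ c x) := by
  refine le_antisymm ?_ (hX.two_mul_dist_le ρ hx x)
  have := dist_triangle x (act ρ c x) (act ρ (c + c) x)
  rw [dist_act_act, add_sub_cancel_right] at this
  linarith

theorem IsCAT0.mem_isomMinSet_double (hX : IsCAT0 X) {c : L} {x : X}
    (hx : x ∈ isomMinSet (act ρ c)) : x ∈ isomMinSet (act ρ (c + c)) := by
  rw [mem_isomMinSet_iff]
  intro y
  rw [dist_comm, dist_comm _ y, hX.dist_double ρ hx]
  exact hX.two_mul_dist_le ρ hx y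

theorem IsCAT0.mem_isomMinSet_pow (hX : IsCAT0 X) {c : L} {x : X}
    (hx : x ∈ isomMinSet (act ρ c)) (k : ℕ) : x ∈ isomMinSet (act ρ (2 ^ k • c)) := by
  induction k with
  | zero => simpa using hx
  | succ k ih =>
    have := hX.mem_isomMinSet_double ρ ih
    rwa [← two_nsmul, ← mul_nsmul', ← pow_succ'] at this

theorem IsCAT0.dist_pow (hX : IsCAT0 X) {c : L} {x : X} (hx : x ∈ isomMinSet (act ρ c)) (k : ℕ) :
    dist x (act ρ (2 ^ k • c) x) = 2 ^ k * dist x (act ρ c x) := by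
  induction k with
  | zero => simp
  | succ k ih =>
    have := hX.dist_double ρ (hX.mem_isomMinSet_pow ρ hx k)
    rw [← two_nsmul, ← mul_nsmul', ← pow_succ'] at this
    rw [this, ih]; ring

theorem dist_pow_le (c : L) (x : X) (k : ℕ) :
    dist x (act ρ (2 ^ k • c) x) ≤ 2 ^ k * dist x (act ρ c x) := by
  induction k with
  | zero => simp
  | succ k ih =>
    have := dist_triangle x (act ρ (2 ^ k • c) x) (act ρ (2 ^ k • c + 2 ^ k • c) x)
    rw [dist_act_act, add_sub_cancel_right, ← two_nsmul, ← mul_nsmul', ← pow_succ'] at this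
    rw [pow_succ (2 : ℝ)]
    linarith

/-- Displacements of bounded distance from each other have the same rate of growth, so a point
that `c` moves along a geodesic line is moved by the least possible distance. -/
theorem mem_isomMinSet_of_dist_pow {c : L} {x : X}
    (h : ∀ k : ℕ, dist x (act ρ (2 ^ k • c) x) = 2 ^ k * dist x (act ρ c x)) :
    x ∈ isomMinSet (act ρ c) := by
  rw [mem_isomMinSet_iff]
  intro y
  rw [dist_comm, dist_comm _ y]
  by_contra! hlt
  obtain ⟨k, hk⟩ := pow_unbounded_of_one_lt
    (2 * dist x y / (dist x (act ρ c x) - dist y (act ρ c y))) one_lt_two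
  rw [div_lt_iff₀ (sub_pos.2 hlt)] at hk
  have h1 := dist_triangle4 x y (act ρ (2 ^ k • c) y) (act ρ (2 ^ k • c) x)
  rw [(act ρ _).dist_eq, dist_comm y x, h] at h1
  have h2 := dist_pow_le ρ c y k
  linarith

theorem neg_mem_isomMinSet {c : L} {x : X} (hx : x ∈ isomMinSet (act ρ c)) :
    x ∈ isomMinSet (act ρ (-c)) := by
  rw [mem_isomMinSet_iff] at hx ⊢
  intro y
  rw [dist_comm, dist_act_neg, dist_comm, dist_comm _ y, dist_act_neg, dist_comm y]
  exact hx y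

/-- On `Min(a) ∩ Min(b)` the quadrilateral inequalities for `a, b` and for `a + b, a - b` together
leave room for equality only. -/
theorem IsCAT0.parallelogram (hX : IsCAT0 X) {a b : L} {x : X} (ha : x ∈ isomMinSet (act ρ a))
    (hb : x ∈ isomMinSet (act ρ b)) :
    dist x (act ρ (a + b) x) ^ 2 + dist x (act ρ (a - b) x) ^ 2 =
      2 * dist x (act ρ a x) ^ 2 + 2 * dist x (act ρ b x) ^ 2 := by
  refine le_antisymm (hX.parallelogram_le ρ a b x) ?_
  have h := hX.parallelogram_le ρ (a + b) (a - b) x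
  rw [add_add_sub_cancel, add_sub_sub_cancel, hX.dist_double ρ ha, hX.dist_double ρ hb] at h
  linarith

theorem IsCAT0.add_mem_isomMinSet (hX : IsCAT0 X) {a b : L} {x : X}
    (ha : x ∈ isomMinSet (act ρ a)) (hb : x ∈ isomMinSet (act ρ b)) :
    x ∈ isomMinSet (act ρ (a + b)) := by
  refine mem_isomMinSet_of_dist_pow ρ fun k => ?_
  have h1 := hX.parallelogram ρ (hX.mem_isomMinSet_pow ρ ha k) (hX.mem_isomMinSet_pow ρ hb k)
  have h2 := hX.parallelogram ρ ha hb
  rw [hX.dist_pow ρ ha, hX.dist_pow ρ hb, ← nsmul_add, ← nsmul_sub] at h1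
  have h3 := dist_pow_le ρ (a + b) x k
  have h4 := dist_pow_le ρ (a - b) x k
  have h5 : dist x (act ρ (2 ^ k • (a - b)) x) ^ 2 ≤ (2 ^ k * dist x (act ρ (a - b) x)) ^ 2 := by
    gcongr
  refine le_antisymm h3 ((sq_le_sq₀ (by positivity) dist_nonneg).1 ?_)
  linear_combination h5 - h1 + (2 ^ k) ^ 2 * h2

/-- The elements of `L` whose min set contains `x`. -/
def minimizedAt (hX : IsCAT0 X) (x : X) : AddSubgroup L where
  carrier := {c | x ∈ isomMinSet (act ρ c)}
  zero_mem' := by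
    change x ∈ isomMinSet (act ρ 0)
    rw [mem_isomMinSet_iff]
    intro y
    simp [act_zero]
  add_mem' := fun ha hb => hX.add_mem_isomMinSet ρ ha hb
  neg_mem' := fun hc => neg_mem_isomMinSet ρ hc

/-- Finitely many commuting semi-simple isometries have a common point in their min sets: the
nearest point projection to the min sets of all but one commutes with the remaining one. -/
theorem IsCAT0.nonempty_biInter_isomMinSet [CompleteSpace X] [Nonempty X] (hX : IsCAT0 X)
    (hss : ∀ c : L, IsSemisimpleIsom (act ρ c)) (s : Finset L) :
    (⋂ c ∈ s, isomMinSet (act ρ c)).Nonempty := by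
  classical
  induction s using Finset.induction_on with
  | empty => simp
  | insert a s _ ih =>
    set C := ⋂ c ∈ s, isomMinSet (act ρ c) with hCdef
    have hcl : IsClosed C := isClosed_biInter fun c _ => isClosed_isomMinSet _
    have hC : GeodesicallyConvex C := by
      intro x hx y hy t ht m hm
      simp only [hCdef, Set.mem_iInter] at hx hy ⊢
      exact fun c hc => hX.convex_isomMinSet _ (hx c hc) (hy c hc) t ht m hm
    have hinv : ∀ (b : L) (x : X), x ∈ C → act ρ b x ∈ C := by
      intro b x hx
      simp only [hCdef, Set.mem_iInter] at hx ⊢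
      exact fun c hc => map_mem_isomMinSet (act_comm ρ c b) (hx c hc)
    obtain ⟨x, hx⟩ := hss a
    obtain ⟨p, hp⟩ := hX.exists_nearest ih hcl hC x
    have hap : IsNearest C (act ρ a x) (act ρ a p) := by
      refine ⟨hinv a p hp.1, fun y hy => ?_⟩
      have := hp.2 _ (hinv (-a) y hy)
      rw [(act ρ a).dist_eq]
      rwa [← (act ρ a).dist_eq x (act ρ (-a) y), ← act_add, add_neg_cancel, act_zero] at this
    have hpa : p ∈ isomMinSet (act ρ a) := by
      rw [mem_isomMinSet_iff]
      exact fun y => (hX.dist_nearest_le hC hap hp).trans (mem_isomMinSet_iff.1 hx y)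
    refine ⟨p, ?_⟩
    rw [Finset.set_biInter_insert]
    exact ⟨hpa, hp.1⟩

theorem IsCAT0.nonempty_minSet [CompleteSpace X] [Nonempty X] (hX : IsCAT0 X)
    [AddGroup.FG L] (hss : ∀ c : L, IsSemisimpleIsom (act ρ c)) : (minSet ρ).Nonempty := by
  obtain ⟨s, hs⟩ := (AddGroup.fg_def.1 ‹AddGroup.FG L›)
  obtain ⟨x, hx⟩ := hX.nonempty_biInter_isomMinSet ρ hss s
  simp only [Set.mem_iInter] at hx
  refine ⟨x, Set.mem_iInter.2 fun c => ?_⟩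
  have h1 : AddSubgroup.closure (s : Set L) ≤ minimizedAt ρ hX x :=
    (AddSubgroup.closure_le _).2 hx
  exact h1 (hs ▸ AddSubgroup.mem_top c)

end MinSets

/-! ### Lattices in Euclidean space -/

section Lattices

theorem additive_of_midpoint {L : Type*} [AddCommGroup L] {g : L → ℝ} (h0 : g 0 = 0)
    (h : ∀ c a, g (c + a) + g (c - a) = 2 * g c) (u v : L) : g (u + v) = g u + g v := by
  have h1 := h (u + v) (u - v)
  have h2 := h u u
  have h3 := h v v
  rw [add_add_sub_cancel, add_sub_sub_cancel] at h1
  rw [sub_self, h0] at h2 h3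
  linarith

/-- The polar form of a function that satisfies the parallelogram law is biadditive. -/
theorem exists_bilin_of_parallelogram {L : Type*} [AddCommGroup L] {q : L → ℝ}
    (h : ∀ a b, q (a + b) + q (a - b) = 2 * q a + 2 * q b) :
    ∃ β : L →ₗ[ℤ] L →ₗ[ℤ] ℝ, (∀ a b, β a b = (q (a + b) - q a - q b) / 2) ∧
      ∀ a, β a a = q a := by
  have h0 : q 0 = 0 := by
    have := h 0 0
    rw [add_zero, sub_zero] at this
    linarith
  have hadd : ∀ b u v, (q (u + v + b) - q (u + v) - q b) / 2 =
      (q (u + b) - q u - q b) / 2 + (q (v + b) - q v - q b) / 2 := by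
    intro b
    refine additive_of_midpoint (g := fun a => (q (a + b) - q a - q b) / 2) (by simp [h0]) ?_
    intro c a
    have h1 := h (c + b) a
    have h2 := h c a
    rw [show c + b + a = c + a + b by abel, show c + b - a = c - a + b by abel] at h1
    linarith
  let β₁ : L → L →+ ℝ := fun a => AddMonoidHom.mk' (fun b => (q (a + b) - q a - q b) / 2) (by
    intro u v
    have := hadd a u v
    simp only [add_comm _ a] at this
    linarith)
  let β : L →+ L →+ ℝ := AddMonoidHom.mk' β₁ (by
    intro u v
    ext b
    exact hadd b u v)
  let β' : L →+ L →ₗ[ℤ] ℝ := AddMonoidHom.mk' (fun a => (β a).toIntLinearMap) (by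
    intro u v
    ext b
    simp)
  refine ⟨β'.toIntLinearMap, fun a b => rfl, fun a => ?_⟩
  change (q (a + a) - q a - q a) / 2 = q a
  have := h a a
  rw [sub_self, h0] at this
  linarith

variable {L : Type*} [AddCommGroup L]

/-- The rational multiples of the points of a lattice are dense in the span of the lattice. -/
theorem mem_of_mem_span_of_isClosed {E : Type*} [NormedAddCommGroup E] [NormedSpace ℝ E]
    (T : L →ₗ[ℤ] E) {S : Set E} (hS : IsClosed S)
    (h : ∀ (k : ℕ) (c : L), 0 < k → (k : ℝ)⁻¹ • T c ∈ S) {u : E}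
    (hu : u ∈ Submodule.span ℝ (Set.range T)) : u ∈ S := by
  obtain ⟨m, f, g, rfl⟩ := Submodule.mem_span_set'.1 hu
  choose c hc using fun i => (g i).2
  have hlim : ∀ x : ℝ, Filter.Tendsto (fun k : ℕ => ((k : ℝ)⁻¹ * (⌊(k : ℝ) * x⌋ : ℝ)))
      Filter.atTop (nhds x) := by
    intro x
    have h1 : Filter.Tendsto (fun k : ℕ => x - (k : ℝ)⁻¹) Filter.atTop (nhds x) := by
      simpa using (tendsto_const_nhds (x := x)).sub (tendsto_inv_atTop_nhds_zero_nat (𝕜 := ℝ))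
    refine tendsto_of_tendsto_of_tendsto_of_le_of_le' h1 tendsto_const_nhds ?_ ?_
    · filter_upwards [Filter.eventually_gt_atTop 0] with k hk
      have hk' : (0 : ℝ) < k := by exact_mod_cast hk
      have := (Int.sub_one_lt_floor ((k : ℝ) * x)).le
      have h2 : x - (k : ℝ)⁻¹ = (k : ℝ)⁻¹ * (k * x - 1) := by field_simp
      rw [h2]
      gcongr
    · filter_upwards [Filter.eventually_gt_atTop 0] with k hk
      have hk' : (0 : ℝ) < k := by exact_mod_cast hk
      have h2 : x = (k : ℝ)⁻¹ * (k * x) := by field_simp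
      conv_rhs => rw [h2]
      have := Int.floor_le ((k : ℝ) * x)
      gcongr
  have hlim' : Filter.Tendsto
      (fun k : ℕ => ∑ i, ((k : ℝ)⁻¹ * (⌊(k : ℝ) * f i⌋ : ℝ)) • (g i : E))
      Filter.atTop (nhds (∑ i, f i • (g i : E))) :=
    tendsto_finsetSum _ fun i _ => (hlim (f i)).smul_const _
  refine hS.mem_of_tendsto hlim' ?_
  filter_upwards [Filter.eventually_gt_atTop 0] with k hk
  have := h k (∑ i, ⌊(k : ℝ) * f i⌋ • c i) hk
  simp only [map_sum, map_zsmul, hc, Finset.smul_sum] at this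
  simpa only [mul_smul, Int.cast_smul_eq_zsmul] using this

/-- A non-negative function on `L ≃ ℤⁿ` that satisfies the parallelogram law is the square of the
Euclidean norm of the image of a linear map to `𝔼ⁿ`: a basis is sent to the columns of the square
root of its Gram matrix. The map need not be injective. -/
theorem exists_euclidean_map [Module.Free ℤ L] [Module.Finite ℤ L] {n : ℕ}
    (hn : Module.finrank ℤ L = n) {q : L → ℝ} (hq : ∀ c, 0 ≤ q c)
    (h : ∀ a b, q (a + b) + q (a - b) = 2 * q a + 2 * q b) :
    ∃ T : L →ₗ[ℤ] EuclideanSpace ℝ (Fin n), ∀ c, ‖T c‖ ^ 2 = q c := by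
  obtain ⟨β, hβ, hβq⟩ := exists_bilin_of_parallelogram h
  have hsymm : ∀ a b, β a b = β b a := by
    intro a b
    rw [hβ, hβ, add_comm]; ring
  let e := Module.finBasisOfFinrankEq ℤ L hn
  let G : Matrix (Fin n) (Fin n) ℝ := Matrix.of fun i j => β (e i) (e j)
  let T₀ : L →ₗ[ℤ] (Fin n → ℝ) := e.constr ℤ fun i => Pi.single i 1
  have hT₀ : ∀ c i, T₀ c i = e.repr c i := by
    intro c i
    simp [T₀, Module.Basis.constr_apply_fintype, Finset.sum_apply, Pi.single_apply]
  have hspan : Submodule.span ℝ (Set.range T₀) = ⊤ := by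
    rw [eq_top_iff, ← (Pi.basisFun ℝ (Fin n)).span_eq]
    refine Submodule.span_mono ?_
    rintro _ ⟨i, rfl⟩
    exact ⟨e i, by simp [T₀]⟩
  have hG : ∀ c, T₀ c ⬝ᵥ G.mulVec (T₀ c) = q c := by
    intro c
    have h1 : β c c = ∑ j, ∑ i, (e.repr c j : ℝ) * ((e.repr c i : ℝ) * β (e i) (e j)) := by
      conv_lhs => rw [← e.sum_repr c]
      simp only [map_sum, map_zsmul, LinearMap.sum_apply, LinearMap.smul_apply, Finset.smul_sum,
        zsmul_eq_mul]
    rw [← hβq, h1]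
    simp only [Matrix.mulVec, dotProduct, hT₀, G, Matrix.of_apply, Finset.mul_sum]
    rw [Finset.sum_comm]
    refine Finset.sum_congr rfl fun i _ => Finset.sum_congr rfl fun j _ => ?_
    ring
  have hpos : G.PosSemidef := by
    refine Matrix.PosSemidef.of_dotProduct_mulVec_nonneg ?_ fun x => ?_
    · ext i j
      simp [G, hsymm (e i)]
    · have hcl : IsClosed {x : Fin n → ℝ | 0 ≤ x ⬝ᵥ G.mulVec x} :=
        isClosed_le continuous_const
          (continuous_id.dotProduct (continuous_const.matrix_mulVec continuous_id))
      refine mem_of_mem_span_of_isClosed T₀ hcl (fun k c _ => ?_) (hspan ▸ Submodule.mem_top)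
      change 0 ≤ ((k : ℝ)⁻¹ • T₀ c) ⬝ᵥ G.mulVec ((k : ℝ)⁻¹ • T₀ c)
      rw [Matrix.mulVec_smul, smul_dotProduct, dotProduct_smul, hG, smul_eq_mul, smul_eq_mul]
      have := hq c
      positivity
  obtain ⟨A, hAG⟩ : ∃ A : Matrix (Fin n) (Fin n) ℝ, A.transpose * A = G := by
    open scoped MatrixOrder in
    refine ⟨CFC.sqrt G, ?_⟩
    have h1 : (CFC.sqrt G).transpose = CFC.sqrt G := by
      simpa [Matrix.IsHermitian] using (Matrix.nonneg_iff_posSemidef.1 (CFC.sqrt_nonneg G)).1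
    rw [h1]
    exact CFC.sqrt_mul_sqrt_self G hpos.nonneg
  let T : L →ₗ[ℤ] EuclideanSpace ℝ (Fin n) :=
    ((WithLp.linearEquiv 2 ℝ (Fin n → ℝ)).symm.toLinearMap.restrictScalars ℤ) ∘ₗ
      (A.mulVecLin.restrictScalars ℤ) ∘ₗ T₀
  refine ⟨T, fun c => ?_⟩
  have h1 : T c = WithLp.toLp 2 (A.mulVec (T₀ c)) := rfl
  rw [h1, EuclideanSpace.norm_sq_eq, ← hG, ← hAG, ← Matrix.mulVec_mulVec,
    Matrix.dotProduct_mulVec, Matrix.vecMul_transpose]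
  simp [dotProduct, sq]

/-- If only finitely many vectors `T c` are short, then `T` is injective and its image is discrete,
so that the image spans a real subspace of dimension `n`. -/
theorem bijective_liftBaseChange [Module.Free ℤ L] [Module.Finite ℤ L] {n : ℕ}
    (hn : Module.finrank ℤ L = n) (T : L →ₗ[ℤ] EuclideanSpace ℝ (Fin n)) {r : ℝ} (hr : 0 < r)
    (hfin : {c | ‖T c‖ < r}.Finite) : Function.Bijective (T.liftBaseChange ℝ) := by
  -- a non-zero element of the kernel would have infinitely many multiples of norm `0`
  have hinj : Function.Injective T := by
    rw [← LinearMap.ker_eq_bot, LinearMap.ker_eq_bot']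
    intro c hc
    by_contra hne
    refine Set.infinite_of_injective_forall_mem (f := fun k : ℤ => k • c) ?_ ?_ hfin
    · exact smul_left_injective ℤ hne
    · intro k
      simp [hc, hr]
  have hspan : Submodule.span ℤ (Set.range T) = LinearMap.range T := by
    rw [← LinearMap.coe_range, Submodule.span_eq]
  have hdisc : DiscreteTopology (Submodule.span ℤ (Set.range T)) := by
    rw [hspan]
    have hball : (Metric.ball (0 : LinearMap.range T) r).Finite := by
      refine (hfin.image T.rangeRestrict).subset ?_
      rintro ⟨_, c, rfl⟩ hc
      refine ⟨c, ?_, rfl⟩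
      simpa using hc
    refine discreteTopology_of_isOpen_singleton_zero ?_
    have hcl : IsClosed (Metric.ball (0 : LinearMap.range T) r \ {0}) :=
      (hball.subset Set.sdiff_subset).isClosed
    have : ({0} : Set (LinearMap.range T)) =
        Metric.ball 0 r ∩ (Metric.ball (0 : LinearMap.range T) r \ {0})ᶜ := by
      ext x
      simp only [Set.mem_singleton_iff, Set.mem_inter_iff, Set.mem_compl_iff, Set.mem_sdiff]
      constructor
      · rintro rfl
        simp [hr]
      · tauto
    rw [this]
    exact Metric.isOpen_ball.inter hcl.isOpen_compl
  have hrank := Real.finrank_eq_int_finrank_of_discrete hdisc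
  rw [Set.finrank, Set.finrank, hspan, LinearMap.finrank_range_of_inj hinj, hn] at hrank
  have htop : Submodule.span ℝ (Set.range T) = ⊤ :=
    Submodule.eq_top_of_finrank_eq (by simpa using hrank)
  have hsurj : Function.Surjective (T.liftBaseChange ℝ) := by
    rw [← LinearMap.range_eq_top, eq_top_iff, ← htop, Submodule.span_le]
    rintro _ ⟨c, rfl⟩
    exact ⟨1 ⊗ₜ c, by simp⟩
  refine ⟨?_, hsurj⟩
  refine (LinearMap.injective_iff_surjective_of_finrank_eq_finrank ?_).2 hsurj
  rw [Module.finrank_baseChange, hn]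
  simp

/-- An additive function on a lattice is the inner product with a vector. -/
theorem exists_inner_eq {E : Type*} [NormedAddCommGroup E] [InnerProductSpace ℝ E]
    [FiniteDimensional ℝ E] (T : L →ₗ[ℤ] E) (hT : Function.Injective (T.liftBaseChange ℝ))
    (g : L →+ ℝ) : ∃ p : E, ∀ c, inner ℝ p (T c) = g c := by
  obtain ⟨f, hf⟩ := LinearMap.exists_leftInverse_of_injective _ (LinearMap.ker_eq_bot.2 hT)
  let F : E →ₗ[ℝ] ℝ := (g.toIntLinearMap.liftBaseChange ℝ) ∘ₗ f
  refine ⟨(InnerProductSpace.toDual ℝ E).symm (LinearMap.toContinuousLinearMap F), fun c => ?_⟩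
  rw [InnerProductSpace.toDual_symm_apply]
  have h1 : T c = T.liftBaseChange ℝ (1 ⊗ₜ c) := by simp
  have h2 : f (T.liftBaseChange ℝ (1 ⊗ₜ c)) = 1 ⊗ₜ c := LinearMap.congr_fun hf _
  change g.toIntLinearMap.liftBaseChange ℝ (f (T c)) = g c
  rw [h1, h2]
  simp

theorem span_range_eq_top {E : Type*} [AddCommGroup E] [Module ℝ E] {T : L →ₗ[ℤ] E}
    (hT : Function.Surjective (T.liftBaseChange ℝ)) : Submodule.span ℝ (Set.range T) = ⊤ := by
  rw [eq_top_iff]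
  rintro u -
  obtain ⟨v, rfl⟩ := hT u
  induction v using TensorProduct.induction_on with
  | zero => simp
  | tmul t c =>
    rw [LinearMap.liftBaseChange_tmul]
    exact Submodule.smul_mem _ _ (Submodule.subset_span ⟨c, rfl⟩)
  | add a b ha hb =>
    rw [map_add]
    exact add_mem ha hb

end Lattices

/-! ### Flats in the min set -/

section Flats
variable {X : Type*} [MetricSpace X] {L : Type*} [AddCommGroup L]
  (ρ : Multiplicative L →* (X ≃ᵢ X))

theorem act_mem_minSet {x : X} (hx : x ∈ minSet ρ) (c : L) : act ρ c x ∈ minSet ρ := by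
  refine Set.mem_iInter.2 fun b => ?_
  exact map_mem_isomMinSet (act_comm ρ b c) (Set.mem_iInter.1 hx b)

theorem image_act_minSet (c : L) : act ρ c '' minSet ρ = minSet ρ := by
  refine Set.Subset.antisymm ?_ fun x hx => ?_
  · rintro _ ⟨x, hx, rfl⟩
    exact act_mem_minSet ρ hx c
  · refine ⟨act ρ (-c) x, act_mem_minSet ρ hx _, ?_⟩
    rw [← act_add, add_neg_cancel, act_zero]

theorem dist_act_eq_translationLength {x : X} (hx : x ∈ minSet ρ) (c : L) :
    dist x (act ρ c x) = translationLength (act ρ c) := by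
  rw [dist_comm]
  exact Set.mem_iInter.1 hx c

theorem IsCAT0.convex_minSet (hX : IsCAT0 X) : GeodesicallyConvex (minSet ρ) := by
  intro x hx y hy t ht m hm
  exact Set.mem_iInter.2 fun c =>
    hX.convex_isomMinSet _ (Set.mem_iInter.1 hx c) (Set.mem_iInter.1 hy c) t ht m hm

/-- Translation lengths are the norms of the vectors of a lattice in Euclidean space. -/
theorem IsCAT0.exists_translation_map (hX : IsCAT0 X) [Module.Free ℤ L] [Module.Finite ℤ L] {n : ℕ}
    (hn : Module.finrank ℤ L = n) (hproper : IsProperAction ρ) (hne : (minSet ρ).Nonempty) :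
    ∃ T : L →ₗ[ℤ] EuclideanSpace ℝ (Fin n), (∀ c, ‖T c‖ = translationLength (act ρ c)) ∧
      Function.Bijective (T.liftBaseChange ℝ) := by
  obtain ⟨x, hx⟩ := hne
  obtain ⟨T, hT⟩ := exists_euclidean_map hn (q := fun c => dist x (act ρ c x) ^ 2)
    (fun c => sq_nonneg _)
    (fun a b => hX.parallelogram ρ (Set.mem_iInter.1 hx a) (Set.mem_iInter.1 hx b))
  have hT' : ∀ c, ‖T c‖ = dist x (act ρ c x) := fun c =>
    (pow_left_inj₀ (norm_nonneg _) dist_nonneg two_ne_zero).1 (hT c)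
  obtain ⟨r, hr, hfin⟩ := hproper x
  refine ⟨T, fun c => (hT' c).trans (dist_act_eq_translationLength ρ hx c),
    bijective_liftBaseChange hn T hr (hfin.subset fun c hc => ?_)⟩
  refine ⟨act ρ c x, ⟨x, Metric.mem_ball_self hr, rfl⟩, ?_⟩
  rw [Metric.mem_ball, dist_comm, ← hT']
  exact hc


section Translates
variable {E : Type*} [NormedAddCommGroup E]

/-- The square of the distance between the components of `x` and `y` orthogonal to the flats. -/
def transverseSq (P : X → E) (x y : X) : ℝ := dist x y ^ 2 - ‖P x - P y‖ ^ 2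

theorem transverseSq_comm (P : X → E) (x y : X) : transverseSq P x y = transverseSq P y x := by
  rw [transverseSq, transverseSq, dist_comm, norm_sub_rev]

/-- `z` lies on the flat through `x`, at the position `v` relative to `x`. That the flat is the
same is expressed by the transverse distances to all points of the min set. -/
def IsTranslate (P : X → E) (v : E) (x z : X) : Prop :=
  z ∈ minSet ρ ∧ P z = v + P x ∧ ∀ w ∈ minSet ρ, transverseSq P z w = transverseSq P x w

theorem IsTranslate.unique {ρ : Multiplicative L →* (X ≃ᵢ X)} {P : X → E} {v : E} {x z z' : X}
    (h : IsTranslate ρ P v x z)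
    (h' : IsTranslate ρ P v x z') : z = z' := by
  have h1 : transverseSq P z z' = transverseSq P z' z' := by
    rw [h.2.2 z' h'.1, h'.2.2 z' h'.1]
  rw [transverseSq, transverseSq, h.2.1, h'.2.1] at h1
  simpa using h1

end Translates

variable {E : Type*} [NormedAddCommGroup E] [InnerProductSpace ℝ E]

/-- The flat strip theorem for the orbits of `x` and `y`: the squared distance between `x` and
`c y` is a quadratic polynomial in `c` whose leading part does not depend on `x` and `y`. That its
second differences are not too small is the CN inequality, and that they are not too large is the
quadrilateral inequality. -/
theorem IsCAT0.exists_dist_sq_eq (hX : IsCAT0 X) [FiniteDimensional ℝ E] {T : L →ₗ[ℤ] E}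
    (hT : ∀ c, ‖T c‖ = translationLength (act ρ c))
    (hinj : Function.Injective (T.liftBaseChange ℝ)) {x y : X} (hx : x ∈ minSet ρ)
    (hy : y ∈ minSet ρ) :
    ∃ p : E, ∀ c,
      dist x (act ρ c y) ^ 2 = dist x y ^ 2 + ‖T c‖ ^ 2 - 2 * inner ℝ p (T c) := by
  have hlen : ∀ z ∈ minSet ρ, ∀ c, dist z (act ρ c z) = ‖T c‖ := fun z hz c =>
    (dist_act_eq_translationLength ρ hz c).trans (hT c).symm
  have hsec : ∀ c a, dist x (act ρ (c + a) y) ^ 2 + dist x (act ρ (c - a) y) ^ 2 =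
      2 * dist x (act ρ c y) ^ 2 + 2 * ‖T a‖ ^ 2 := by
    intro c a
    apply le_antisymm
    · have h := hX.quadrilateral x (act ρ (-a) x) (act ρ (c - a) y) (act ρ c y)
      rw [dist_act_act, dist_act_act, dist_act_act, hlen x hx, dist_comm _ x,
        show c - (-a) = c + a by abel, show c - a - (-a) = c by abel,
        show c - (c - a) = a by abel, hlen y hy, map_neg, norm_neg] at h
      linarith
    · have ht : (1 / 2 : ℝ) ∈ Set.Icc (0 : ℝ) 1 := by norm_num
      have hd : dist (act ρ (c + a) y) (act ρ (c - a) y) = 2 * ‖T a‖ := by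
        rw [dist_act_act, hlen y hy, show c - a - (c + a) = -((2 : ℤ) • a) by rw [two_smul]; abel,
          map_neg, norm_neg, map_smul, ← Int.cast_smul_eq_zsmul ℝ, norm_smul]
        simp
      have hm : Divides (act ρ (c + a) y) (act ρ (c - a) y) (1 / 2) (act ρ c y) := by
        constructor
        · rw [hd, dist_act_act, hlen y hy, sub_add_cancel_left, map_neg, norm_neg]; ring
        · rw [hd, dist_act_act, hlen y hy, sub_sub_cancel_left, map_neg, norm_neg]; ring
      have h := hX.cn ht hm x
      rw [hd, dist_comm _ x, dist_comm _ x, dist_comm _ x] at h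
      linarith
  have hpar : ∀ c a, ‖T (c + a)‖ ^ 2 + ‖T (c - a)‖ ^ 2 = 2 * ‖T c‖ ^ 2 + 2 * ‖T a‖ ^ 2 := by
    intro c a
    rw [map_add, map_sub, norm_add_sq_real, norm_sub_sq_real]; ring
  let g : L →+ ℝ := AddMonoidHom.mk'
    (fun c => (dist x y ^ 2 + ‖T c‖ ^ 2 - dist x (act ρ c y) ^ 2) / 2) <| by
      refine additive_of_midpoint (g := fun c =>
        (dist x y ^ 2 + ‖T c‖ ^ 2 - dist x (act ρ c y) ^ 2) / 2) (by simp [act_zero]) ?_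
      intro c a
      have h1 := hsec c a
      have h2 := hpar c a
      linarith
  obtain ⟨p, hp⟩ := exists_inner_eq T hinj g
  refine ⟨p, fun c => ?_⟩
  rw [hp]
  change _ = _ - 2 * ((dist x y ^ 2 + ‖T c‖ ^ 2 - dist x (act ρ c y) ^ 2) / 2)
  ring

/-- An additive function on `L` that is bounded above vanishes. -/
theorem eq_zero_of_inner_le {T : L →ₗ[ℤ] E} (hspan : Submodule.span ℝ (Set.range T) = ⊤) {p : E}
    {K : ℝ} (h : ∀ c, inner ℝ p (T c) ≤ K) : p = 0 := by
  have h0 : ∀ c, inner ℝ p (T c) ≤ 0 := by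
    intro c
    by_contra! hpos
    obtain ⟨k, hk⟩ := exists_nat_gt (K / inner ℝ p (T c))
    rw [div_lt_iff₀ hpos] at hk
    have := h (k • c)
    rw [map_nsmul, ← Nat.cast_smul_eq_nsmul ℝ, inner_smul_right] at this
    linarith
  have h1 : p ∈ {u : E | inner ℝ p u ≤ 0} := by
    refine mem_of_mem_span_of_isClosed T (isClosed_le (by fun_prop) continuous_const)
      (fun k c _ => ?_) (hspan ▸ Submodule.mem_top)
    change inner ℝ p ((k : ℝ)⁻¹ • T c) ≤ 0
    rw [inner_smul_right]
    exact mul_nonpos_of_nonneg_of_nonpos (by positivity) (h0 c)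
  change inner ℝ p p ≤ 0 at h1
  rw [real_inner_self_eq_norm_sq] at h1
  exact norm_eq_zero.1 (pow_eq_zero_iff two_ne_zero |>.1 (le_antisymm h1 (sq_nonneg _)))

/-- `P` assigns to the points of the min set their Euclidean coordinates, which are determined up
to a translation by the distances to the points of an orbit. -/
def IsFlatCoordinate (T : L →ₗ[ℤ] E) (P : X → E) : Prop :=
  ∀ x ∈ minSet ρ, ∀ y ∈ minSet ρ, ∀ c,
    dist x (act ρ c y) ^ 2 = dist x y ^ 2 + ‖T c‖ ^ 2 - 2 * inner ℝ (P x - P y) (T c)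

/-- The linear parts of the polynomials of `IsCAT0.exists_dist_sq_eq` form a cocycle, hence a
coboundary: by the triangle inequality, their failure to do so is an additive function on `L` that
is bounded above. -/
theorem IsCAT0.exists_isFlatCoordinate (hX : IsCAT0 X) [FiniteDimensional ℝ E] {T : L →ₗ[ℤ] E}
    (hT : ∀ c, ‖T c‖ = translationLength (act ρ c))
    (hbij : Function.Bijective (T.liftBaseChange ℝ)) (hne : (minSet ρ).Nonempty) :
    ∃ P : X → E, IsFlatCoordinate ρ T P := by
  have hex : ∀ x y : X, ∃ p : E, x ∈ minSet ρ → y ∈ minSet ρ → ∀ c,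
      dist x (act ρ c y) ^ 2 = dist x y ^ 2 + ‖T c‖ ^ 2 - 2 * inner ℝ p (T c) := by
    intro x y
    by_cases hx : x ∈ minSet ρ
    · by_cases hy : y ∈ minSet ρ
      · obtain ⟨p, hp⟩ := hX.exists_dist_sq_eq ρ hT hbij.1 hx hy
        exact ⟨p, fun _ _ => hp⟩
      · exact ⟨0, fun _ h => absurd h hy⟩
    · exact ⟨0, fun h => absurd h hx⟩
  choose p hp using hex
  have hcocycle : ∀ x ∈ minSet ρ, ∀ y ∈ minSet ρ, ∀ z ∈ minSet ρ, p x y + p y z - p x z = 0 := by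
    intro x hx y hy z hz
    refine eq_zero_of_inner_le (span_range_eq_top hbij.2)
      (K := (2 * dist x y ^ 2 + 2 * dist y z ^ 2 - dist x z ^ 2) / 4) fun c => ?_
    have h1 := dist_triangle x (act ρ c y) (act ρ (c + c) z)
    rw [dist_act_act, add_sub_cancel_right] at h1
    have h2 : dist x (act ρ (c + c) z) ^ 2 ≤ (dist x (act ρ c y) + dist y (act ρ c z)) ^ 2 := by
      gcongr
    have h3 := sq_nonneg (dist x (act ρ c y) - dist y (act ρ c z))
    have hxy := hp x y hx hy c
    have hyz := hp y z hy hz c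
    have hxz := hp x z hx hz (c + c)
    rw [map_add, inner_add_right, norm_add_sq_real, real_inner_self_eq_norm_sq] at hxz
    rw [inner_sub_left, inner_add_left]
    linarith
  obtain ⟨o, ho⟩ := hne
  refine ⟨fun x => p x o, fun x hx y hy c => ?_⟩
  have : p x o - p y o = p x y := by
    rw [← sub_eq_zero, ← neg_eq_zero, ← hcocycle x hx y hy o ho]; abel
  simp only [this]
  exact hp x y hx hy c

namespace IsFlatCoordinate
variable {ρ} {T : L →ₗ[ℤ] E} {P : X → E} (hP : IsFlatCoordinate ρ T P)
include hP

theorem dist_act_self {x : X} (hx : x ∈ minSet ρ) (c : L) : dist x (act ρ c x) = ‖T c‖ := by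
  have := hP x hx x hx c
  rw [sub_self, inner_zero_left, dist_self] at this
  exact (pow_left_inj₀ dist_nonneg (norm_nonneg _) two_ne_zero).1 (by linarith)

theorem map_act (hspan : Submodule.span ℝ (Set.range T) = ⊤) {x : X} (hx : x ∈ minSet ρ) (c : L) :
    P (act ρ c x) = T c + P x := by
  have h : P (act ρ c x) - P x - T c = 0 := by
    refine eq_zero_of_inner_le hspan (K := 0) fun b => ?_
    have h1 := hP _ (act_mem_minSet ρ hx c) x hx b
    rw [dist_act_act, hP.dist_act_self hx, dist_comm, hP.dist_act_self hx, map_sub,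
      norm_sub_sq_real] at h1
    rw [inner_sub_left _ (T c), real_inner_comm (T b) (T c)]
    linarith
  rw [sub_sub, sub_eq_zero] at h
  rw [h, add_comm]

/-- Comparing `d(x, c y)` with `d(y, c y) - d(x, y)` bounds the inner products of `P x - P y` with
lattice vectors, and hence, by density, with all vectors. -/
theorem norm_sub_le (hspan : Submodule.span ℝ (Set.range T) = ⊤) {x y : X} (hx : x ∈ minSet ρ)
    (hy : y ∈ minSet ρ) : ‖P x - P y‖ ≤ dist x y := by
  have h0 : ∀ c, inner ℝ (P x - P y) (T c) ≤ dist x y * ‖T c‖ := by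
    intro c
    have h2 := hP x hx y hy c
    have h4 : (dist x y - ‖T c‖) ^ 2 ≤ dist x (act ρ c y) ^ 2 := by
      rw [sq_le_sq, abs_of_nonneg (dist_nonneg (x := x)), abs_sub_le_iff]
      have h5 := dist_triangle y x (act ρ c y)
      have h6 := dist_triangle_right x y (act ρ c y)
      rw [hP.dist_act_self hy, dist_comm y x] at h5
      rw [hP.dist_act_self hy] at h6
      constructor <;> linarith
    linarith
  have h1 : P x - P y ∈ {u : E | inner ℝ (P x - P y) u ≤ dist x y * ‖u‖} := by
    refine mem_of_mem_span_of_isClosed T (isClosed_le (by fun_prop) (by fun_prop))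
      (fun k c _ => ?_) (hspan ▸ Submodule.mem_top)
    change inner ℝ (P x - P y) ((k : ℝ)⁻¹ • T c) ≤ dist x y * ‖(k : ℝ)⁻¹ • T c‖
    rw [inner_smul_right, norm_smul, Real.norm_of_nonneg (by positivity), mul_left_comm]
    gcongr
    exact h0 c
  have h2 : ‖P x - P y‖ * ‖P x - P y‖ ≤ dist x y * ‖P x - P y‖ := by
    rw [← real_inner_self_eq_norm_mul_norm]
    exact h1
  rcases (norm_nonneg (P x - P y)).eq_or_lt with h3 | h3
  · rw [← h3]
    exact dist_nonneg
  · exact le_of_mul_le_mul_right h2 h3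

end IsFlatCoordinate

namespace IsFlatCoordinate
variable {ρ} {T : L →ₗ[ℤ] E} {P : X → E} (hP : IsFlatCoordinate ρ T P)
  (hspan : Submodule.span ℝ (Set.range T) = ⊤)
include hP hspan

theorem isTranslate_act {x : X} (hx : x ∈ minSet ρ) (c : L) :
    IsTranslate ρ P (T c) x (act ρ c x) := by
  refine ⟨act_mem_minSet ρ hx c, hP.map_act hspan hx c, fun w hw => ?_⟩
  rw [transverseSq, transverseSq, hP.map_act hspan hx c, dist_comm, hP w hw x hx c,
    add_sub_assoc (T c), norm_add_sq_real, dist_comm w x, real_inner_comm, ← neg_sub (P x) (P w),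
    inner_neg_right]
  ring

/-- The component of `P z - P x` along `T c` is `t • T c`, and there is no room for another one
because `‖P z - P x‖ ≤ d(z, x) = t ‖T c‖`. -/
theorem map_divides {x z : X} {c : L} {t : ℝ} (hx : x ∈ minSet ρ) (hz : z ∈ minSet ρ)
    (hd : Divides x (act ρ c x) t z) (ht : t ∈ Set.Icc (0 : ℝ) 1) : P z = t • T c + P x := by
  have h1 := hP z hz x hx c
  rw [hd.2, dist_comm z x, hd.1, hP.dist_act_self hx] at h1
  have h2 := hP.norm_sub_le hspan hz hx
  rw [dist_comm, hd.1, hP.dist_act_self hx] at h2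
  have h3 : ‖P z - P x‖ ^ 2 ≤ (t * ‖T c‖) ^ 2 := by gcongr
  have h4 : ‖P z - P x - t • T c‖ ^ 2 ≤ 0 := by
    rw [norm_sub_sq_real, inner_smul_right, norm_smul, Real.norm_of_nonneg ht.1]
    linear_combination h3 - t * h1
  have h5 : P z - P x - t • T c = 0 :=
    norm_eq_zero.1 (pow_eq_zero_iff two_ne_zero |>.1 (le_antisymm h4 (sq_nonneg _)))
  rw [sub_sub, sub_eq_zero] at h5
  rw [h5, add_comm]

theorem transverseSq_divides_le (hX : IsCAT0 X) {x z : X} {c : L} {t : ℝ} (hx : x ∈ minSet ρ)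
    (hz : z ∈ minSet ρ) (hd : Divides x (act ρ c x) t z) (ht : t ∈ Set.Icc (0 : ℝ) 1) {w : X}
    (hw : w ∈ minSet ρ) : transverseSq P z w ≤ transverseSq P x w := by
  have h1 := hX.cn ht hd w
  have h2 := (hP.isTranslate_act hspan hx c).2.2 w hw
  rw [hP.dist_act_self hx] at h1
  rw [transverseSq, transverseSq, hP.map_act hspan hx, add_sub_assoc, norm_add_sq_real] at h2
  rw [transverseSq, transverseSq, hP.map_divides hspan hx hz hd ht, add_sub_assoc,
    norm_add_sq_real, inner_smul_left, norm_smul, Real.norm_of_nonneg ht.1, conj_trivial]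
  linear_combination h1 + t * h2

theorem exists_isTranslate_smul (hX : IsCAT0 X) {x : X} (hx : x ∈ minSet ρ) (c : L) {t : ℝ}
    (ht : t ∈ Set.Icc (0 : ℝ) 1) : ∃ z, IsTranslate ρ P (t • T c) x z := by
  obtain ⟨z, hd⟩ := hX.exists_divides x (act ρ c x) ht
  have hz : z ∈ minSet ρ := hX.convex_minSet ρ hx (act_mem_minSet ρ hx c) t ht z hd
  refine ⟨z, hz, hP.map_divides hspan hx hz hd ht, fun w hw =>
    le_antisymm (hP.transverseSq_divides_le hspan hX hx hz hd ht hw) ?_⟩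
  -- conversely, `x` lies between `z` and its translate by `-c`
  have hd' : Divides z (act ρ (-c) z) t x := by
    constructor
    · rw [hP.dist_act_self hz, map_neg, norm_neg, dist_comm, hd.1, hP.dist_act_self hx]
    · rw [hP.dist_act_self hz, map_neg, norm_neg, ← (act ρ c).dist_eq, ← act_add, add_neg_cancel,
        act_zero, dist_comm, hd.2, hP.dist_act_self hx]
  exact hP.transverseSq_divides_le hspan hX hz hx hd' ht hw

/-- Every vector of `E` translates the min set along the flats, since the vectors that do form a
subgroup that contains all real multiples of lattice vectors. -/
theorem exists_isTranslate (hX : IsCAT0 X) {x : X} (hx : x ∈ minSet ρ) (v : E) :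
    ∃ z, IsTranslate ρ P v x z := by
  have hv : v ∈ Submodule.span ℝ (Set.range T) := hspan ▸ Submodule.mem_top
  suffices ∀ s : ℝ, ∀ x ∈ minSet ρ, ∃ z, IsTranslate ρ P (s • v) x z by
    simpa using this 1 x hx
  induction hv using Submodule.span_induction with
  | mem u hu =>
    obtain ⟨c, rfl⟩ := hu
    intro s x hx
    -- `s • T c` is a fraction, between `0` and `1`, of an integral multiple of `T c`
    obtain ⟨k, hk⟩ := exists_nat_gt |s|
    have hk0 : (0 : ℝ) < k := (abs_nonneg s).trans_lt hk
    have hk' : s = (|s| / k) * (k * SignType.sign s) := by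
      rw [← mul_assoc, div_mul_cancel₀ _ hk0.ne', abs_mul_sign]
    have := hP.exists_isTranslate_smul hspan hX hx ((k * (SignType.sign s : ℤ)) • c)
      (t := |s| / k) ⟨by positivity, (div_le_one hk0).2 hk.le⟩
    rw [map_zsmul, ← Int.cast_smul_eq_zsmul ℝ, smul_smul] at this
    rw [hk']
    simpa using this
  | zero =>
    intro s x hx
    exact ⟨x, hx, by simp, fun w hw => rfl⟩
  | add u v _ _ hu hv =>
    intro s x hx
    obtain ⟨z, hz⟩ := hu s x hx
    obtain ⟨z', hz'⟩ := hv s z hz.1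
    refine ⟨z', hz'.1, ?_, fun w hw => (hz'.2.2 w hw).trans (hz.2.2 w hw)⟩
    rw [hz'.2.1, hz.2.1, smul_add]; abel
  | smul a u _ hu =>
    intro s x hx
    rw [smul_smul]
    exact hu (s * a) x hx

end IsFlatCoordinate

end Flats

/-! ### The product decomposition -/

section Product
variable {X : Type*} [MetricSpace X] {L : Type*} [AddCommGroup L]
  {ρ : Multiplicative L →* (X ≃ᵢ X)}

theorem IsTranslate.refl {E : Type*} [NormedAddCommGroup E] {P : X → E} {x : X}
    (hx : x ∈ minSet ρ) : IsTranslate ρ P 0 x x :=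
  ⟨hx, (zero_add _).symm, fun _ _ => rfl⟩

theorem IsTranslate.trans {E : Type*} [NormedAddCommGroup E] {P : X → E} {v v' : E} {x z z' : X}
    (h : IsTranslate ρ P v x z) (h' : IsTranslate ρ P v' z z') :
    IsTranslate ρ P (v' + v) x z' :=
  ⟨h'.1, by rw [h'.2.1, h.2.1, add_assoc], fun w hw => (h'.2.2 w hw).trans (h.2.2 w hw)⟩

theorem dist_sq_euclideanProd {Y : Type*} [MetricSpace Y] {n : ℕ} (a b : EuclideanProd Y n) :
    dist a b ^ 2 = dist a.fst b.fst ^ 2 + dist a.snd b.snd ^ 2 := by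
  rw [WithLp.prod_dist_eq_add (by norm_num)]
  simp only [ENNReal.toReal_ofNat, Real.rpow_ofNat]
  rw [← Real.sqrt_eq_rpow, Real.sq_sqrt (by positivity)]

/-- The slice of the min set that the flats cross at the origin of their coordinates. -/
abbrev Slice (ρ : Multiplicative L →* (X ≃ᵢ X)) {E : Type*} [Zero E] (P : X → E) : Type _ :=
  {x : X // x ∈ minSet ρ ∧ P x = 0}

/-- The min set is the product of the slice with Euclidean space: the point `(y, p)` is the
translate of `y` by `p`. -/
theorem IsCAT0.exists_isometryEquiv (hX : IsCAT0 X) {n : ℕ}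
    {T : L →ₗ[ℤ] EuclideanSpace ℝ (Fin n)} {P : X → EuclideanSpace ℝ (Fin n)}
    (hP : IsFlatCoordinate ρ T P) (hspan : Submodule.span ℝ (Set.range T) = ⊤) :
    ∃ e : minSet ρ ≃ᵢ EuclideanProd (Slice ρ P) n,
      ∀ (y : Slice ρ P) p, IsTranslate ρ P p (y : X) (pt e y p) := by
  choose tr htr using fun (x : minSet ρ) v => hP.exists_isTranslate hspan hX x.2 v
  let F : EuclideanProd (Slice ρ P) n → minSet ρ := fun a =>
    ⟨tr ⟨a.fst, a.fst.2.1⟩ a.snd, (htr _ _).1⟩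
  have hF : ∀ a, IsTranslate ρ P a.snd (a.fst : X) (F a : X) := fun a => htr _ _
  let G : minSet ρ → EuclideanProd (Slice ρ P) n := fun x =>
    WithLp.toLp 2 (⟨tr x (-P x), (htr _ _).1, by rw [(htr _ _).2.1, neg_add_cancel]⟩, P x)
  have hFG : ∀ x, F (G x) = x := by
    intro x
    have h : IsTranslate ρ P (P x + -P x) (x : X) (F (G x) : X) :=
      (htr x (-P x)).trans (hF (G x))
    rw [add_neg_cancel] at h
    exact Subtype.ext (h.unique (IsTranslate.refl x.2))
  have hiso : Isometry F := by
    refine Isometry.of_dist_eq fun a b => ?_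
    rw [← pow_left_inj₀ dist_nonneg dist_nonneg two_ne_zero, dist_sq_euclideanProd]
    have h : transverseSq P (F a : X) (F b : X) = transverseSq P (a.fst : X) (b.fst : X) := by
      rw [(hF a).2.2 _ (hF b).1, transverseSq_comm, (hF b).2.2 _ a.fst.2.1, transverseSq_comm]
    rw [transverseSq, transverseSq, (hF a).2.1, (hF b).2.1, a.fst.2.2, b.fst.2.2, add_zero,
      add_zero, sub_self, norm_zero, ← dist_eq_norm] at h
    rw [Subtype.dist_eq, Subtype.dist_eq]
    linarith
  exact ⟨(IsometryEquiv.mk' F G hFG hiso).symm, fun (y : Slice ρ P) p => hF (WithLp.toLp 2 (y, p))⟩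

theorem pt_injective {Y : Type*} [MetricSpace Y] {n : ℕ} (e : minSet ρ ≃ᵢ EuclideanProd Y n)
    (y : Y) : Function.Injective (pt e y) := by
  intro p q h
  have := e.symm.injective (Subtype.ext h)
  simpa using this

theorem IsFlatCoordinate.act_pt {n : ℕ} {T : L →ₗ[ℤ] EuclideanSpace ℝ (Fin n)}
    {P : X → EuclideanSpace ℝ (Fin n)} (hP : IsFlatCoordinate ρ T P)
    (hspan : Submodule.span ℝ (Set.range T) = ⊤) {e : minSet ρ ≃ᵢ EuclideanProd (Slice ρ P) n}
    (he : ∀ (y : Slice ρ P) p, IsTranslate ρ P p (y : X) (pt e y p)) (c : L) (y : Slice ρ P)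
    (p : EuclideanSpace ℝ (Fin n)) : act ρ c (pt e y p) = pt e y (T c + p) :=
  ((he y p).trans (hP.isTranslate_act hspan (he y p).1 c)).unique (he y _)

theorem IsAffineExtension.unique {Y : Type*} [MetricSpace Y] {n : ℕ}
    {e : minSet ρ ≃ᵢ EuclideanProd Y n} {y : Y}
    {τ τ' : (ℝ ⊗[ℤ] L) →ₗ[ℝ] EuclideanSpace ℝ (Fin n)} (h : IsAffineExtension e y τ)
    (h' : IsAffineExtension e y τ') : τ' = τ := by
  ext c : 3
  have := pt_injective e y ((h' c 0).symm.trans (h c 0))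
  simpa using this

theorem translationsAreTorsor_of_bijective {V E : Type*} [AddCommGroup V] [Module ℝ V]
    [AddCommGroup E] [Module ℝ E] {τ : V →ₗ[ℝ] E} (h : Function.Bijective τ) :
    TranslationsAreTorsor τ := by
  constructor
  · intro v p hv
    exact h.1 ((add_eq_right.1 hv).trans (map_zero τ).symm)
  · intro p q
    obtain ⟨v, hv⟩ := h.2 (q - p)
    exact ⟨v, by rw [hv, sub_add_cancel]⟩

end Product

/-! ### The commensurator -/

section Commensurators
variable {L : Type*} [AddCommGroup L]

/-- A finite-index subgroup of `L` spans the vector space `K ⊗ L`. -/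
theorem linearMap_ext_of_finiteIndex {K V : Type*} [Field K] [CharZero K] [AddCommGroup V]
    [Module K V] (L' : AddSubgroup L) [L'.FiniteIndex] {f g : (K ⊗[ℤ] L) →ₗ[K] V}
    (h : ∀ b ∈ L', f (1 ⊗ₜ b) = g (1 ⊗ₜ b)) : f = g := by
  ext l : 3
  have hm : (L'.index : K) ≠ 0 := by
    exact_mod_cast AddSubgroup.FiniteIndex.index_ne_zero (H := L')
  have h1 : (1 : K) ⊗ₜ[ℤ] (L'.index • l) = (L'.index : K) • ((1 : K) ⊗ₜ[ℤ] l) := by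
    rw [TensorProduct.tmul_smul, Nat.cast_smul_eq_nsmul]
  have h2 := h _ (AddSubgroup.nsmul_index_mem L' l)
  rw [h1, map_smul, map_smul] at h2
  simpa using smul_right_injective V hm h2

/-- On `1 ⊗ L'`, the automorphism of `L ⊗ ℚ` given by `ϕ : L' ≃+ L''` is `ϕ` itself. -/
theorem commMap_tmul (L' L'' : AddSubgroup L) [L'.FiniteIndex] [L''.FiniteIndex] (ϕ : L' ≃+ L'')
    (b : L') : commMap L' L'' ϕ (1 ⊗ₜ (b : L)) = 1 ⊗ₜ (ϕ b : L) := by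
  have h1 : (LinearEquiv.ofBijective (inclQ L') (inclQ_bijective L')).symm (1 ⊗ₜ (b : L)) =
      1 ⊗ₜ b := by
    rw [LinearEquiv.symm_apply_eq]
    simp [inclQ]
  rw [commMap, LinearEquiv.trans_apply, LinearEquiv.trans_apply, h1]
  simp [inclQ]

theorem extendToReal_tmul {T : (ℚ ⊗[ℤ] L) ≃ₗ[ℚ] (ℚ ⊗[ℤ] L)} {b c : L}
    (h : T (1 ⊗ₜ b) = 1 ⊗ₜ c) : extendToReal T (1 ⊗ₜ b) = 1 ⊗ₜ c := by
  rw [extendToReal, LinearEquiv.trans_apply, LinearEquiv.trans_apply,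
    TensorProduct.AlgebraTensorModule.cancelBaseChange_symm_tmul]
  simp [h]

variable {X : Type*} [MetricSpace X] {ρ : Multiplicative L →* (X ≃ᵢ X)}

/-- A torsion-free group that acts properly acts faithfully. -/
theorem IsProperAction.injective_act [Module.IsTorsionFree ℤ L] [Nonempty X]
    (h : IsProperAction ρ) :
    Function.Injective (act ρ) := by
  have h1 : ∀ c, act ρ c = 1 → c = 0 := by
    intro c hc
    by_contra hne
    obtain ⟨x⟩ := ‹Nonempty X›
    obtain ⟨r, hr, hfin⟩ := h x
    refine Set.infinite_of_injective_forall_mem (f := fun k : ℤ => k • c) ?_ ?_ hfin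
    · exact smul_left_injective ℤ hne
    · intro k
      have hk : act ρ (k • c) = 1 := by
        rw [act, ofAdd_zsmul, map_zpow]
        change act ρ c ^ k = 1
        rw [hc, one_zpow]
      exact ⟨x, ⟨x, Metric.mem_ball_self hr, by rw [hk]; rfl⟩, Metric.mem_ball_self hr⟩
  intro a b hab
  refine sub_eq_zero.1 (h1 _ ?_)
  rw [act, ofAdd_sub, map_div]
  exact div_eq_one.2 hab

open scoped Pointwise in
/-- The elements of `L` that an element of the commensurator conjugates into `L`, and the elements
of `L` that it conjugates from `L`. -/
theorem exists_finiteIndex_of_mem_commensurator {φ : X ≃ᵢ X}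
    (hφ : φ ∈ Subgroup.Commensurable.commensurator ρ.range) :
    ∃ L' L'' : AddSubgroup L, L'.FiniteIndex ∧ L''.FiniteIndex ∧
      (∀ b, b ∈ L' ↔ ∃ c, act ρ c = φ * act ρ b * φ⁻¹) ∧
      ∀ c, c ∈ L'' ↔ ∃ b, act ρ c = φ * act ρ b * φ⁻¹ := by
  rw [Subgroup.Commensurable.commensurator_mem_iff] at hφ
  let κ : Multiplicative L →* (X ≃ᵢ X) := (MulAut.conj φ).toMonoidHom.comp ρ
  have hκ : κ.range = ConjAct.toConjAct φ • ρ.range := MonoidHom.range_comp _ _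
  rw [← hκ] at hφ
  have h' : (ρ.range.comap κ).index ≠ 0 := by
    rw [Subgroup.index_comap]
    exact hφ.2
  have h'' : (κ.range.comap ρ).index ≠ 0 := by
    rw [Subgroup.index_comap]
    exact hφ.1
  refine ⟨Subgroup.toAddSubgroup' (ρ.range.comap κ), Subgroup.toAddSubgroup' (κ.range.comap ρ),
    ⟨h'⟩, ⟨h''⟩, fun b => ?_, fun c => ?_⟩
  · exact Iff.rfl
  · exact exists_congr fun b => eq_comm

/-- Conjugation by an element of the commensurator is an isomorphism between subgroups of finite
index. -/
theorem exists_isConjugationBy (hinj : Function.Injective (act ρ)) {φ : X ≃ᵢ X}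
    (hφ : φ ∈ Subgroup.Commensurable.commensurator ρ.range) :
    ∃ (L' L'' : AddSubgroup L) (ϕ : L' ≃+ L''),
      L'.FiniteIndex ∧ L''.FiniteIndex ∧ IsConjugationBy ρ φ ϕ := by
  obtain ⟨L', L'', h', h'', hL', hL''⟩ := exists_finiteIndex_of_mem_commensurator hφ
  have hex : ∀ b : L', ∃ c : L'', act ρ (c : L) = φ * act ρ (b : L) * φ⁻¹ := by
    rintro ⟨b, hb⟩
    obtain ⟨c, hc⟩ := (hL' b).1 hb
    exact ⟨⟨c, (hL'' c).2 ⟨b, hc⟩⟩, hc⟩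
  choose f hf using hex
  have hadd : ∀ a b : L, act ρ (a + b) = act ρ a * act ρ b := fun a b => map_mul ρ _ _
  let F : L' →+ L'' := AddMonoidHom.mk' f fun a b => Subtype.ext <| hinj <| by
    rw [hf, AddSubgroup.coe_add, AddSubgroup.coe_add, hadd, hadd, hf, hf]
    group
  have hF : Function.Bijective F := by
    constructor
    · intro a b hab
      have h1 : φ * act ρ (a : L) * φ⁻¹ = φ * act ρ (b : L) * φ⁻¹ := by
        rw [← hf, ← hf]
        exact congrArg (fun c : L'' => act ρ (c : L)) hab
      exact Subtype.ext (hinj (mul_left_cancel (mul_right_cancel h1)))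
    · rintro ⟨c, hc⟩
      obtain ⟨b, hb⟩ := (hL'' c).1 hc
      exact ⟨⟨b, (hL' b).2 ⟨c, hb⟩⟩, Subtype.ext (hinj ((hf _).trans hb.symm))⟩
  exact ⟨L', L'', AddEquiv.ofBijective F hF, h', h'', hf⟩

/-- Two isomorphisms given by conjugation agree where both are defined. -/
theorem commMap_eq_of_isConjugationBy (hinj : Function.Injective (act ρ)) {φ : X ≃ᵢ X}
    {L' L'' M' M'' : AddSubgroup L} [L'.FiniteIndex] [L''.FiniteIndex] [M'.FiniteIndex]
    [M''.FiniteIndex] {ϕ : L' ≃+ L''} {ψ : M' ≃+ M''} (hϕ : IsConjugationBy ρ φ ϕ)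
    (hψ : IsConjugationBy ρ φ ψ) : commMap L' L'' ϕ = commMap M' M'' ψ := by
  refine LinearEquiv.toLinearMap_injective (linearMap_ext_of_finiteIndex (L' ⊓ M') ?_)
  rintro b ⟨hb, hb'⟩
  have h1 : (ϕ ⟨b, hb⟩ : L) = ψ ⟨b, hb'⟩ := hinj ((hϕ _).trans (hψ ⟨b, hb'⟩).symm)
  have h2 := commMap_tmul L' L'' ϕ ⟨b, hb⟩
  rw [h1] at h2
  exact h2.trans (commMap_tmul M' M'' ψ ⟨b, hb'⟩).symm

theorem inner_eq_polar {E : Type*} [NormedAddCommGroup E] [InnerProductSpace ℝ E]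
    (T : L →ₗ[ℤ] E) (b c : L) :
    inner ℝ (T b) (T c) = (‖T (b + c)‖ ^ 2 - ‖T b‖ ^ 2 - ‖T c‖ ^ 2) / 2 := by
  rw [map_add, norm_add_sq_real]; ring

/-- Conjugation preserves translation lengths, hence the inner product on a finite-index
subgroup. -/
theorem bilin_extendToReal {E : Type*} [NormedAddCommGroup E] [InnerProductSpace ℝ E]
    {T : L →ₗ[ℤ] E} (hT : ∀ c, ‖T c‖ = translationLength (act ρ c))
    {B : LinearMap.BilinForm ℝ (ℝ ⊗[ℤ] L)} (hB : ∀ b c, B (1 ⊗ₜ b) (1 ⊗ₜ c) = inner ℝ (T b) (T c))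
    {φ : X ≃ᵢ X} {L' L'' : AddSubgroup L} [L'.FiniteIndex] [L''.FiniteIndex] {ϕ : L' ≃+ L''}
    (hϕ : IsConjugationBy ρ φ ϕ) (v w : ℝ ⊗[ℤ] L) :
    B (extendToReal (commMap L' L'' ϕ) v) (extendToReal (commMap L' L'' ϕ) w) = B v w := by
  set S := (extendToReal (commMap L' L'' ϕ)).toLinearMap with hS
  have hnorm : ∀ b : L', ‖T (ϕ b)‖ = ‖T b‖ := by
    intro b
    rw [hT, hT, hϕ, translationLength_conj]
  have hST : ∀ b : L', S (1 ⊗ₜ (b : L)) = 1 ⊗ₜ (ϕ b : L) := fun b =>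
    extendToReal_tmul (commMap_tmul L' L'' ϕ b)
  suffices B.compl₁₂ S S = B from LinearMap.congr_fun₂ this v w
  refine linearMap_ext_of_finiteIndex L' fun b hb => linearMap_ext_of_finiteIndex L' fun c hc => ?_
  rw [LinearMap.compl₁₂_apply, hST ⟨b, hb⟩, hST ⟨c, hc⟩, hB, hB, inner_eq_polar, inner_eq_polar,
    ← AddSubgroup.coe_add, ← map_add, hnorm, hnorm, hnorm]
  rfl

end Commensurators

end FlatTorus

theorem mainTheorem3 {X : Type u} [MetricSpace X] [CompleteSpace X] [Nonempty X]
    (hX : FlatTorus.IsCAT0 X)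
    {L : Type w} [AddCommGroup L] [Module.Free ℤ L] [Module.Finite ℤ L]
    (n : ℕ) (hn : Module.finrank ℤ L = n)
    (ρ : Multiplicative L →* (X ≃ᵢ X))
    (hproper : FlatTorus.IsProperAction ρ)
    (hss : ∀ c : L, FlatTorus.IsSemisimpleIsom (FlatTorus.act ρ c)) :
    (FlatTorus.minSet ρ).Nonempty ∧
    (∃ (Y : Type u) (_ : MetricSpace Y)
      (e : FlatTorus.minSet ρ ≃ᵢ FlatTorus.EuclideanProd Y n),
      (∀ c : L, FlatTorus.act ρ c '' FlatTorus.minSet ρ = FlatTorus.minSet ρ ∧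
        ∃ v : EuclideanSpace ℝ (Fin n), ∀ (y : Y) (p : EuclideanSpace ℝ (Fin n)),
          FlatTorus.act ρ c (FlatTorus.pt e y p) = FlatTorus.pt e y (v + p)) ∧
      (∀ y : Y, ∃ τ : (ℝ ⊗[ℤ] L) →ₗ[ℝ] EuclideanSpace ℝ (Fin n),
        FlatTorus.IsAffineExtension e y τ ∧
        (∀ τ', FlatTorus.IsAffineExtension e y τ' → τ' = τ) ∧
        FlatTorus.TranslationsAreTorsor τ)) ∧
    (∃ B : LinearMap.BilinForm ℝ (ℝ ⊗[ℤ] L),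
      FlatTorus.IsInnerProductOf ρ B ∧
      (∀ B', FlatTorus.IsInnerProductOf ρ B' → B' = B) ∧
      (∀ v w, B v w = B w v) ∧ (∀ v, v ≠ 0 → 0 < B v v) ∧
      ∀ φ ∈ Subgroup.Commensurable.commensurator ρ.range,
        ∃ T : (ℚ ⊗[ℤ] L) ≃ₗ[ℚ] (ℚ ⊗[ℤ] L), FlatTorus.IsImageOf ρ φ T ∧
          ∀ v w, B (FlatTorus.extendToReal T v) (FlatTorus.extendToReal T w) = B v w) := by
  have : AddGroup.FG L := Module.Finite.iff_addGroup_fg.1 inferInstance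
  have hne := hX.nonempty_minSet ρ hss
  obtain ⟨T, hT, hbij⟩ := hX.exists_translation_map ρ hn hproper hne
  have hspan := FlatTorus.span_range_eq_top hbij.2
  refine ⟨hne, ?_, ?_⟩
  · obtain ⟨P, hP⟩ := hX.exists_isFlatCoordinate ρ hT hbij hne
    obtain ⟨e, he⟩ := hX.exists_isometryEquiv hP hspan
    have hact := hP.act_pt hspan he
    refine ⟨FlatTorus.Slice ρ P, inferInstance, e, fun c =>
      ⟨FlatTorus.image_act_minSet ρ c, T c, hact c⟩, fun y => ?_⟩
    have hτ : FlatTorus.IsAffineExtension e y (T.liftBaseChange ℝ) := by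
      intro c p
      rw [LinearMap.liftBaseChange_tmul, one_smul]
      exact hact c y p
    exact ⟨_, hτ, fun τ' hτ' => hτ.unique hτ',
      FlatTorus.translationsAreTorsor_of_bijective hbij⟩
  · let B : LinearMap.BilinForm ℝ (ℝ ⊗[ℤ] L) :=
      (innerₗ (EuclideanSpace ℝ (Fin n))).compl₁₂ (T.liftBaseChange ℝ) (T.liftBaseChange ℝ)
    have hBapp : ∀ v w, B v w = inner ℝ (T.liftBaseChange ℝ v) (T.liftBaseChange ℝ w) :=
      fun v w => rfl
    have hBT : ∀ b c, B (1 ⊗ₜ b) (1 ⊗ₜ c) = inner ℝ (T b) (T c) := by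
      intro b c
      simp [hBapp]
    have hB : FlatTorus.IsInnerProductOf ρ B := by
      intro x hx b c
      rw [hBT, FlatTorus.inner_eq_polar, dist_comm _ x,
        FlatTorus.dist_act_eq_translationLength ρ hx, FlatTorus.dist_act_eq_translationLength ρ hx,
        FlatTorus.dist_act_eq_translationLength ρ hx, hT, hT, hT]
    refine ⟨B, hB, fun B' hB' => ?_, fun v w => ?_, fun v hv => ?_, fun φ hφ => ?_⟩
    · obtain ⟨x, hx⟩ := hne
      ext b c : 6
      exact (hB' x hx b c).trans (hB x hx b c).symm
    · rw [hBapp, hBapp, real_inner_comm]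
    · rw [hBapp]
      exact real_inner_self_pos.2 fun h => hv (hbij.1 (h.trans (map_zero _).symm))
    · have hinj := hproper.injective_act
      obtain ⟨L', L'', ϕ, h', h'', hϕ⟩ := FlatTorus.exists_isConjugationBy hinj hφ
      exact ⟨FlatTorus.commMap L' L'' ϕ,
        ⟨⟨L', L'', ϕ, h', h'', hϕ⟩, fun M' M'' _ _ ψ hψ =>
          FlatTorus.commMap_eq_of_isConjugationBy hinj hψ hϕ⟩,
        FlatTorus.bilin_extendToReal hT hBT hϕ⟩
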